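/- Let $k\ge 2$, $N\ge 1$, $n=2^kN$ with $k\le \tfrac12\log_2 n$, and let $r\ge 2^k$. Let $F$ be a field with $q=2^{N}=2^{n/2^k}$ elements, identified with $\{0,1\}^N$ by a fixed bijection, so that a string of $rN$ bits is a vector in $F^r$ (for $r=2^k$ it has exactly $n$ bits). Let $n_0=2m$ be $(n/2^k)^{2/3}$ rounded down to an even integer, and let the gadget $g:(\{0,1\}^{rN})^{k-1}\to\{0,1\}^{n_0}$ output the first $n_0$ bits of the generalized inner product $\mathrm{GIP}(x_2,\dots,x_k)=\sum_{j=1}^r\prod_{i=2}^k x_{i,j}\in F$. For $i\in\{0,\dots,m-1\}$ let $M_i=\{(\ell,\,m+((i+\ell)\bmod m)) : 0\le \ell<m\}$. In the $k$-party Lifted Hidden Matching problem $\mathrm{HM}*g$ the inputs are $x_1\in\{0,\dots,m-1\}$ and $x_2,\dots,x_k\in\{0,1\}^{rN}$; player $i$ sees all inputs except $x_i$; the last player must output $\langle \ell,\ell',b\rangle$ with $(\ell,\ell')\in M_{x_1}$ and $b=g(x_2,\dots,x_k)_\ell\oplus g(x_2,\dots,x_k)_{\ell'}$. In a randomized one-way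 number-on-the-forehead (NOF) protocol, the players $1,\dots,k-1$ in this order each announce one message, depending on what they see, on the earlier messages and on shared randomness, and then player $k$ outputs an answer; the cost is the maximum over all inputs and all random strings of the total number of announced bits, and the error is the maximum over all inputs of the probability of an invalid answer. (a) For every $\delta\in[0,1/2)$ there is a constant $c=c(\delta)>0$ such that for all $k,n,r,F$ as above the randomized one-way NOF communication complexity of $\mathrm{HM}*g$ with error $\delta$ is at least $c\,n^{1/3}/2^{k/3}$. (b) There is a constant $C>0$ such that for all $k,n,r,F$ as above $\mathrm{HM}*g$ has a zero-error quantum one-way NOF protocol in which only the first player speaks, sending a pure state of at most $C\log_2 n$ qubits, and the last player measures it, without shared randomness or entanglement. Together (a) and (b) give an exponential quantum-classical separation for one-way NOF communication. -/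

import Mathlib

open MeasureTheory
open scoped ComplexOrder

noncomputable section

namespace NOF

/-! ### One-way number-on-the-forehead protocols -/

section Model

variable {k : ℕ} [NeZero k]

/-- The player that speaks first. -/
def firstPlayer (k : ℕ) [NeZero k] : Fin k := ⟨0, NeZero.pos k⟩

/-- The player that produces the answer. -/
def lastPlayer (k : ℕ) [NeZero k] : Fin k := ⟨k - 1, Nat.sub_one_lt (NeZero.ne k)⟩

/-- The players before the last one, as players. -/
def sender (i : Fin (k - 1)) : Fin k := Fin.castLE (Nat.sub_le k 1) i

/-- What player `i` can see: every input except the one on the forehead of player `i`. -/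
abbrev View (X : Fin k → Type) (i : Fin k) : Type := (j : Fin k) → j ≠ i → X j

/-- The part of the input `x` that player `i` sees. -/
def view {X : Fin k → Type} (x : (i : Fin k) → X i) (i : Fin k) : View X i := fun j _ => x j

/-- A deterministic one-way protocol. In their fixed order, all players except the last one
announce a bit string that depends on what they see and on the earlier messages; then the last
player outputs an answer in `Z`, depending on what it sees and on all messages. -/
structure DetProtocol (X : Fin k → Type) (Z : Type) where
  msg : (i : Fin (k - 1)) → View X (sender i) →
    ((j : Fin (k - 1)) → j < i → List Bool) → List Bool
  out : View X (lastPlayer k) → (Fin (k - 1) → List Bool) → Z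

namespace DetProtocol

variable {X : Fin k → Type} {Z : Type}

/-- The message that the `i`-th sender announces on input `x`. -/
def transcript (P : DetProtocol X Z) (x : (i : Fin k) → X i) (i : Fin (k - 1)) : List Bool :=
  P.msg i (view x (sender i)) (fun j _ => P.transcript x j)
termination_by i

/-- The answer of the last player on input `x`. -/
def output (P : DetProtocol X Z) (x : (i : Fin k) → X i) : Z :=
  P.out (view x (lastPlayer k)) (P.transcript x)

/-- The total number of bits announced on input `x`. -/
def bits (P : DetProtocol X Z) (x : (i : Fin k) → X i) : ℕ :=
  ∑ i, (P.transcript x i).length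

end DetProtocol

/-- The public-coin randomized one-way communication complexity with error `δ` of the search
problem `R`. A randomized protocol is a family of deterministic ones, indexed by the shared
randomness `ω`; it has error `δ` if on every input the answer is invalid with probability at most
`δ`, and it costs at most `c` if at most `c` bits are announced for every input and every `ω`. -/
def randomizedComplexity {X : Fin k → Type} {Z : Type}
    (R : ((i : Fin k) → X i) → Z → Prop) (δ : ℝ) : ℕ :=
  sInf {c : ℕ | ∃ (Ω : Type) (_ : MeasurableSpace Ω) (μ : Measure Ω) (_ : IsProbabilityMeasure μ)
    (P : Ω → DetProtocol X Z),
      (∀ x, μ {ω | ¬ R x ((P ω).output x)} ≤ ENNReal.ofReal δ) ∧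
      (∀ ω x, (P ω).bits x ≤ c)}

/-- A quantum one-way protocol in which only the first player speaks: it sends a pure state of
`qubits` qubits that depends on what it sees, and the last player performs a measurement, a POVM
that depends on what the last player sees, whose outcome is the answer. The other players are
silent and there is no shared randomness or entanglement. -/
structure QuantumProtocol (X : Fin k → Type) (Z : Type) [Fintype Z] where
  qubits : ℕ
  state : View X (firstPlayer k) → (Fin qubits → Bool) → ℂ
  state_norm : ∀ v, ∑ b, ‖state v b‖ ^ 2 = 1
  effect : View X (lastPlayer k) → Z → Matrix (Fin qubits → Bool) (Fin qubits → Bool) ℂ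
  effect_posSemidef : ∀ v z, (effect v z).PosSemidef
  effect_sum : ∀ v, ∑ z, effect v z = 1

namespace QuantumProtocol

variable {X : Fin k → Type} {Z : Type} [Fintype Z]

/-- The probability (Born rule) that the answer on input `x` is `z`. -/
def prob (Q : QuantumProtocol X Z) (x : (i : Fin k) → X i) (z : Z) : ℝ :=
  (star (Q.state (view x (firstPlayer k))) ⬝ᵥ
    (Matrix.mulVec (Q.effect (view x (lastPlayer k)) z) (Q.state (view x (firstPlayer k))))).re

open Classical in
/-- The probability that the answer on input `x` is invalid for the search problem `R`. -/
def errorProb (Q : QuantumProtocol X Z) (R : ((i : Fin k) → X i) → Z → Prop)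
    (x : (i : Fin k) → X i) : ℝ :=
  ∑ z, if R x z then 0 else Q.prob x z

end QuantumProtocol

end Model

/-! ### The lifted hidden matching problem -/

/-- The perfect matching `M_i = {(ℓ, m + ((i + ℓ) mod m)) : 0 ≤ ℓ < m}` between
`{0, …, m - 1}` and `{m, …, 2m - 1}`. -/
def matching (m : ℕ) (i : Fin m) : Set (Fin (2 * m) × Fin (2 * m)) :=
  {p | ∃ l : Fin m, (p.1 : ℕ) = l ∧ (p.2 : ℕ) = m + ((i : ℕ) + l) % m}

/-- The inputs: `x_1` is an index of a matching, `x_2, …, x_k` are strings of `L` bits. -/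
def HMInput (k m L : ℕ) (i : Fin k) : Type :=
  match i.val with
  | 0 => Fin m
  | _ + 1 => Fin L → Bool

section Problem

variable {k m L : ℕ} [NeZero k]

/-- The input `x_1`. -/
def matchingIndex (x : (i : Fin k) → HMInput k m L i) : Fin m := x ⟨0, NeZero.pos k⟩

/-- The inputs `x_2, …, x_k`. -/
def gadgetInput (x : (i : Fin k) → HMInput k m L i) : Fin (k - 1) → Fin L → Bool :=
  fun i => x ⟨i.val + 1, by have := i.isLt; omega⟩

/-- The lifted hidden matching problem `HM * g`: an answer `⟨ℓ, r, b⟩` is valid if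
`(ℓ, r) ∈ M_{x_1}` and `b = g(x_2, …, x_k)_ℓ ⊕ g(x_2, …, x_k)_r`. -/
def liftedHM (g : (Fin (k - 1) → Fin L → Bool) → Fin (2 * m) → Bool)
    (x : (i : Fin k) → HMInput k m L i) (z : Fin (2 * m) × Fin (2 * m) × Bool) : Prop :=
  (z.1, z.2.1) ∈ matching m (matchingIndex x) ∧
    z.2.2 = xor (g (gadgetInput x) z.1) (g (gadgetInput x) z.2.1)

end Problem

/-! ### The gadget -/

/-- The generalized inner product of `p` vectors in `F ^ r`. -/
def GIP {F : Type} [Field F] {p r : ℕ} (x : Fin p → Fin r → F) : F := ∑ j, ∏ i, x i j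

/-- Cut a string of `r * N` bits into `r` consecutive blocks of `N` bits and read each of them as
an element of `F`. -/
def decode {F : Type} {r N : ℕ} (e : F ≃ (Fin N → Bool)) (y : Fin (r * N) → Bool) : Fin r → F :=
  fun j => e.symm (fun t => y (finProdFinEquiv (j, t)))

/-- The number `m = n_0 / 2` of matchings, where `n_0` is `N ^ (2/3)` rounded down to an even
integer. -/
def numMatchings (N : ℕ) : ℕ := ⌊(N : ℝ) ^ (2 / 3 : ℝ) / 2⌋₊

theorem two_mul_numMatchings_le (N : ℕ) : 2 * numMatchings N ≤ N := by
  have h0 : (0 : ℝ) ≤ (N : ℝ) ^ (2 / 3 : ℝ) / 2 := by positivity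
  have h1 : (numMatchings N : ℝ) ≤ (N : ℝ) ^ (2 / 3 : ℝ) / 2 := Nat.floor_le h0
  have h2 : (N : ℝ) ^ (2 / 3 : ℝ) ≤ N := by
    rcases Nat.eq_zero_or_pos N with rfl | hN
    · norm_num
    · have hN1 : (1 : ℝ) ≤ N := by exact_mod_cast hN
      calc (N : ℝ) ^ (2 / 3 : ℝ) ≤ (N : ℝ) ^ (1 : ℝ) :=
            Real.rpow_le_rpow_of_exponent_le hN1 (by norm_num)
        _ = N := Real.rpow_one _
  have h3 : (2 : ℝ) * numMatchings N ≤ N := by linarith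
  exact_mod_cast h3

/-- The gadget: the first `n_0 = 2 * numMatchings N` bits of the generalized inner product over
the field `F` of `k - 1` vectors with `r` entries. The field elements are identified with bit
strings of length `N` by `e`. -/
def gadget {F : Type} [Field F] {N : ℕ} (e : F ≃ (Fin N → Bool)) (k r : ℕ)
    (y : Fin (k - 1) → Fin (r * N) → Bool) : Fin (2 * numMatchings N) → Bool :=
  fun t => e (GIP (fun i => decode e (y i))) (Fin.castLE (two_mul_numMatchings_le N) t)

end NOF

end

/-! Lower bound. Averaging over the inputs fixes the shared randomness. The first player does not
see `x_1`, so its message `a` is the same for all `m` matching indices, and one may run the protocol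
on all indices in parallel after `a`. For fixed `a`, each later message or answer comes from a
player that misses one of the strings `x_2, …, x_k`. Fixing all transcripts and answers for all
indices therefore cuts the gadget inputs into at most `(2^(k-1) * 4^c * |Z|)^m` disjoint cylinder
intersections, and on each of them the whole vector of answers is constant (`sum_outputs_le`).

On a cylinder intersection the value of GIP is nearly uniform (`sum_cylinder_le`). This is the
Babai–Nisan–Szegedy discrepancy argument: Fourier inversion over `F`, then one Cauchy–Schwarz step
per player (`norm_sum_cylinder_char_pow_le`). For uniform gadget bits, a fixed vector of answers
names at most one edge from each of the `m` edge-disjoint matchings. The sum of its `±1` scores is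
then dominated by a bipartite Rademacher chaos of order two, whose exponential moment at `λ =
1/√(2m)` is at most `√2` (`sum_exp_bilinear_le`, `sum_exp_score_le`).

A protocol of error `δ` has mean total score at least `(1 - 2δ)m`, so by Jensen its exponential
moment is at least `exp((1 - 2δ)√(m/2))`. The at most `2 * 4^c` first messages contribute about `√2`
each, which forces `c` to be of order `√m` (`exp_le_of_protocol`). The discrepancy error is
negligible as long as `m * c` is small against `N`; with `m` about `N^(2/3) / 2` both constraints
meet at `c` of order `N^(1/3)` (`exists_cost_bound`).

Upper bound. The first player sends the uniform superposition of positions with phases `(-1)^(g_t)`.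
The last player measures in the basis `(|ℓ⟩ ± |ℓ'⟩)/√2` over the edges of its matching; an outcome
with the wrong parity is orthogonal to the state (`exists_quantum_protocol`). -/

namespace NOF

/-! ### Exponential moments of Rademacher sums and bilinear chaos -/

/-- The sign `(-1) ^ b`. -/
def sgn (b : Bool) : ℝ := if b then -1 else 1

theorem sum_exp_linear {ι : Type*} [Fintype ι] [DecidableEq ι] (a : ι → ℝ) :
    ∑ α : ι → Bool, Real.exp (∑ u, a u * sgn (α u)) = ∏ u, (2 * Real.cosh (a u)) := by
  simp_rw [Real.exp_sum]
  rw [← Fintype.piFinset_univ, ← Finset.prod_univ_sum (fun _ => Finset.univ)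
    (fun u b => Real.exp (a u * sgn b))]
  refine Finset.prod_congr rfl fun u _ => ?_
  rw [Fintype.sum_bool, Real.cosh_eq]
  simp [sgn]
  ring

theorem sum_exp_linear_le {ι : Type*} [Fintype ι] [DecidableEq ι] (a : ι → ℝ) :
    ∑ α : ι → Bool, Real.exp (∑ u, a u * sgn (α u)) ≤
      2 ^ Fintype.card ι * Real.exp ((∑ u, a u ^ 2) / 2) := by
  rw [sum_exp_linear, Finset.prod_mul_distrib, Finset.prod_const, Finset.card_univ,
    Finset.sum_div, Real.exp_sum]
  gcongr with u
  exact Real.cosh_le_exp_half_sq _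

/-- Gaussian linearization by completing the square: the exponential of a squared linear form
becomes an average of exponentials of linear forms, which factor over independent signs. -/
theorem exp_sq_div_four (x : ℝ) :
    √Real.pi * Real.exp (x ^ 2 / 4) = ∫ y : ℝ, Real.exp (x * y - y ^ 2) := by
  have h : ∀ y : ℝ, Real.exp (x * y - y ^ 2) =
      Real.exp (x ^ 2 / 4) * Real.exp (-1 * (y - x / 2) ^ 2) := by
    intro y; rw [← Real.exp_add]; congr 1; ring
  simp_rw [h]
  rw [integral_const_mul, integral_sub_right_eq_self (fun y : ℝ => Real.exp (-1 * y ^ 2)),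
    integral_gaussian]
  simp [mul_comm]

theorem integrable_exp_mul_sub_sq (x : ℝ) :
    Integrable (fun y : ℝ => Real.exp (x * y - y ^ 2)) := by
  by_contra h
  have := exp_sq_div_four x
  rw [integral_undef h] at this
  have : 0 < √Real.pi * Real.exp (x ^ 2 / 4) := by positivity
  linarith

/-- After linearization the sum over signs costs at most `exp(y²/2)`, against the weight `exp(-y²)`.
The remaining Gaussian `exp(-y²/2)` has mass `√2` relative to the normalization `√π`. -/
theorem sum_exp_sq_linear_le {ι : Type*} [Fintype ι] [DecidableEq ι] (a : ι → ℝ)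
    (ha : ∑ u, a u ^ 2 ≤ 1) :
    ∑ α : ι → Bool, Real.exp ((∑ u, a u * sgn (α u)) ^ 2 / 4) ≤
      2 ^ Fintype.card ι * √2 := by
  have hpi : 0 < √Real.pi := by positivity
  refine le_of_mul_le_mul_left ?_ hpi
  rw [Finset.mul_sum]
  simp_rw [exp_sq_div_four]
  rw [← integral_finsetSum _ (fun α _ => integrable_exp_mul_sub_sq _)]
  have hg : Integrable (fun y : ℝ => Real.exp (-(1 / 2) * y ^ 2)) :=
    integrable_exp_neg_mul_sq (by norm_num)
  calc ∫ y : ℝ, ∑ α : ι → Bool, Real.exp ((∑ u, a u * sgn (α u)) * y - y ^ 2)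
      ≤ ∫ y : ℝ, 2 ^ Fintype.card ι * Real.exp (-(1 / 2) * y ^ 2) := by
        refine integral_mono (integrable_finsetSum _ fun α _ => integrable_exp_mul_sub_sq _)
          (hg.const_mul _) fun y => ?_
        have h1 := sum_exp_linear_le (fun u => a u * y)
        have h2 : ∑ α : ι → Bool, Real.exp ((∑ u, a u * sgn (α u)) * y - y ^ 2) =
            (∑ α : ι → Bool, Real.exp (∑ u, a u * y * sgn (α u))) * Real.exp (-y ^ 2) := by
          rw [Finset.sum_mul]
          refine Finset.sum_congr rfl fun α _ => ?_
          rw [← Real.exp_add, Finset.sum_mul]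
          congr 1
          rw [sub_eq_add_neg]
          congr 1
          exact Finset.sum_congr rfl fun u _ => by ring
        have h3 : (∑ u, (a u * y) ^ 2) / 2 ≤ y ^ 2 / 2 := by
          simp_rw [mul_pow]
          rw [← Finset.sum_mul]
          nlinarith [sq_nonneg y]
        simp only
        rw [h2]
        calc _ ≤ (2 ^ Fintype.card ι * Real.exp (y ^ 2 / 2)) * Real.exp (-y ^ 2) := by
              gcongr; exact h1.trans (by gcongr)
          _ = _ := by
              rw [mul_assoc, ← Real.exp_add]; congr 2; ring
    _ = √Real.pi * (2 ^ Fintype.card ι * √2) := by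
        rw [integral_const_mul, integral_gaussian, show Real.pi / (1 / 2) = Real.pi * 2 by ring,
          Real.sqrt_mul Real.pi_pos.le]
        ring

/-- A decoupled Rademacher chaos of order two has a bounded exponential moment if its coefficients
have square sum at most `1 / 2`. -/
theorem sum_exp_bilinear_le {ι κ : Type*} [Fintype ι] [DecidableEq ι] [Fintype κ] [DecidableEq κ]
    (A : ι → κ → ℝ) (hA : ∑ v, ∑ u, A u v ^ 2 ≤ 1 / 2) :
    ∑ α : ι → Bool, ∑ β : κ → Bool,
      Real.exp (∑ v, (∑ u, A u v * sgn (α u)) * sgn (β v)) ≤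
      2 ^ Fintype.card ι * 2 ^ Fintype.card κ * √2 := by
  set D : κ → ℝ := fun v => ∑ u, A u v ^ 2 with hD
  set S : (ι → Bool) → κ → ℝ := fun α v => ∑ u, A u v * sgn (α u) with hS
  have hD0 : ∀ v, 0 ≤ D v := fun v => Finset.sum_nonneg fun u _ => sq_nonneg _
  have hDz : ∀ v, D v = 0 → ∀ α, S α v = 0 := by
    intro v hv α
    have : ∀ u, A u v = 0 := by
      intro u
      have := (Finset.sum_eq_zero_iff_of_nonneg (fun u _ => sq_nonneg (A u v))).1 hv u
        (Finset.mem_univ _)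
      exact pow_eq_zero_iff (two_ne_zero) |>.1 this
    simp [hS, this]
  have hstep : ∀ v, ∑ α : ι → Bool, Real.exp (S α v ^ 2 / (4 * D v)) ≤
      2 ^ Fintype.card ι * √2 := by
    intro v
    rcases (hD0 v).eq_or_lt with h | h
    · simp only [← h, mul_zero, div_zero, Real.exp_zero, Finset.sum_const, Finset.card_univ,
        Fintype.card_fun, Fintype.card_bool, nsmul_eq_mul, mul_one]
      push_cast
      exact le_mul_of_one_le_right (by positivity) (Real.one_le_sqrt.2 (by norm_num))
    · have hs : 0 < √(D v) := Real.sqrt_pos.2 h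
      have h1 := sum_exp_sq_linear_le (fun u => A u v / √(D v)) (by
        simp_rw [div_pow, Real.sq_sqrt h.le]
        rw [← Finset.sum_div]
        exact (div_self h.ne').le)
      refine le_of_eq_of_le (Finset.sum_congr rfl fun α _ => ?_) h1
      congr 1
      have : ∑ u, A u v / √(D v) * sgn (α u) = S α v / √(D v) := by
        rw [hS, Finset.sum_div]
        exact Finset.sum_congr rfl fun u _ => by ring
      rw [this, div_pow, Real.sq_sqrt h.le, div_div, mul_comm]
  have hβ : ∀ α : ι → Bool, ∑ β : κ → Bool, Real.exp (∑ v, S α v * sgn (β v)) ≤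
      2 ^ Fintype.card κ * Real.exp ((∑ v, S α v ^ 2) / 2) := fun α => sum_exp_linear_le _
  -- Convexity of `exp` decouples the columns: `S²/2` is `2D` times `S²/(4D)`, the weights `2 * D v`
  -- sum to at most `1`, and the missing mass is put at the point `0`.
  have hconv : ∀ α : ι → Bool, Real.exp ((∑ v, S α v ^ 2) / 2) ≤
      ∑ v, (2 * D v) * Real.exp (S α v ^ 2 / (4 * D v)) + (1 - ∑ v, 2 * D v) := by
    intro α
    have hw : ∑ v, 2 * D v ≤ 1 := by rw [← Finset.mul_sum]; linarith
    have := convexOn_exp.map_sum_le (t := (Finset.univ : Finset (Option κ)))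
      (w := fun o => o.elim (1 - ∑ v, 2 * D v) (fun v => 2 * D v))
      (p := fun o => o.elim 0 (fun v => S α v ^ 2 / (4 * D v)))
      (by rintro (_ | v) _
          · simpa using hw
          · simpa using hD0 v)
      (by simp [Fintype.sum_option])
      (fun _ _ => Set.mem_univ _)
    simp only [Fintype.sum_option, Option.elim, smul_eq_mul, mul_zero, zero_add, Real.exp_zero,
      mul_one] at this
    rw [add_comm (1 - _)] at this
    refine le_of_eq_of_le ?_ this
    congr 1
    rw [Finset.sum_div]
    refine Finset.sum_congr rfl fun v _ => ?_
    rcases (hD0 v).eq_or_lt with h | h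
    · simp [hDz v h.symm]
    · field_simp; ring
  have hw : 0 ≤ 1 - ∑ v, 2 * D v := by rw [← Finset.mul_sum]; linarith
  calc ∑ α : ι → Bool, ∑ β : κ → Bool, Real.exp (∑ v, S α v * sgn (β v))
      ≤ ∑ α : ι → Bool, 2 ^ Fintype.card κ *
          (∑ v, (2 * D v) * Real.exp (S α v ^ 2 / (4 * D v)) + (1 - ∑ v, 2 * D v)) := by
        gcongr with α
        exact (hβ α).trans (by gcongr; exact hconv α)
    _ = 2 ^ Fintype.card κ * (∑ v, (2 * D v) * ∑ α : ι → Bool, Real.exp (S α v ^ 2 / (4 * D v))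
          + 2 ^ Fintype.card ι * (1 - ∑ v, 2 * D v)) := by
        rw [← Finset.mul_sum, Finset.sum_add_distrib, Finset.sum_comm]
        simp_rw [← Finset.mul_sum]
        simp only [Finset.sum_const, Finset.card_univ, Fintype.card_fun, Fintype.card_bool,
          nsmul_eq_mul]
        push_cast
        ring
    _ ≤ 2 ^ Fintype.card κ * (∑ v, (2 * D v) * (2 ^ Fintype.card ι * √2)
          + (2 ^ Fintype.card ι * √2) * (1 - ∑ v, 2 * D v)) := by
        gcongr with v
        · exact hstep _
        · exact le_mul_of_one_le_right (by positivity) (Real.one_le_sqrt.2 (by norm_num))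
    _ = _ := by
        rw [← Finset.sum_mul]; ring

/-- Swapping two independent sign vectors on the coordinates outside `p` is an involution. It lets
the two sides of a bipartite form be treated as independent vectors. -/
theorem sum_merge {ι : Type*} [Fintype ι] [DecidableEq ι] (p : ι → Prop) [DecidablePred p]
    (G : (ι → Bool) → ℝ) :
    ∑ α : ι → Bool, ∑ β : ι → Bool, G (fun u => if p u then α u else β u) =
      2 ^ Fintype.card ι * ∑ y, G y := by
  let s : (ι → Bool) × (ι → Bool) ≃ (ι → Bool) × (ι → Bool) :=
    Function.Involutive.toPerm
      (fun x => (fun u => if p u then x.1 u else x.2 u, fun u => if p u then x.2 u else x.1 u))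
      (by
        intro x
        ext u
        · by_cases h : p u <;> simp [h]
        · by_cases h : p u <;> simp [h])
  rw [← Fintype.sum_prod_type' (fun α β : ι → Bool => G (fun u => if p u then α u else β u))]
  refine (Fintype.sum_equiv s _ (fun x => G x.1) (fun x => rfl)).trans ?_
  rw [Fintype.sum_prod_type]
  simp [Finset.mul_sum]

/-- Exponential moment of a signed sum of parities of distinct edges between the positions
satisfying `p` and the other positions. -/
theorem sum_exp_parity_le {ι E : Type*} [Fintype ι] [DecidableEq ι] [Fintype E] [DecidableEq E]
    (p : ι → Prop) [DecidablePred p] (l r : E → ι) (hl : ∀ i, p (l i)) (hr : ∀ i, ¬ p (r i))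
    (hinj : Function.Injective fun i => (l i, r i)) (b : E → ℝ) (hb : ∀ i, b i ^ 2 = 1) (t : ℝ)
    (ht : t ^ 2 * Fintype.card E ≤ 1 / 2) :
    ∑ y : ι → Bool, Real.exp (t * ∑ i, b i * (sgn (y (l i)) * sgn (y (r i)))) ≤
      2 ^ Fintype.card ι * √2 := by
  have h2 : (0 : ℝ) < 2 ^ Fintype.card ι := by positivity
  refine le_of_mul_le_mul_left ?_ h2
  rw [← sum_merge p]
  -- The coefficient matrix of the form. Distinct edges put at most one term into each entry, so the
  -- sum of the squared entries is exactly `t²` times the number of edges.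
  set A : ι → ι → ℝ := fun u v => t * ∑ i, if l i = u ∧ r i = v then b i else 0 with hA
  have hsq : ∀ u v, A u v ^ 2 = t ^ 2 * ∑ i, if l i = u ∧ r i = v then 1 else 0 := by
    intro u v
    rw [hA]
    simp only [mul_pow]
    congr 1
    by_cases h : ∃ j, l j = u ∧ r j = v
    · obtain ⟨j, rfl, rfl⟩ := h
      have : ∀ i, (l i = l j ∧ r i = r j) ↔ i = j := fun i =>
        ⟨fun h => hinj (Prod.ext h.1 h.2), by rintro rfl; exact ⟨rfl, rfl⟩⟩
      simp [this, hb]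
    · push Not at h
      have : ∀ i, ¬ (l i = u ∧ r i = v) := fun i hi => h i hi.1 hi.2
      simp [this]
  have hfrob : ∑ v, ∑ u, A u v ^ 2 ≤ 1 / 2 := by
    simp_rw [hsq, ← Finset.mul_sum]
    have : ∑ v, ∑ u, ∑ i : E, (if l i = u ∧ r i = v then (1 : ℝ) else 0) = Fintype.card E := by
      calc _ = ∑ i : E, ∑ v, ∑ u, (if l i = u ∧ r i = v then (1 : ℝ) else 0) := by
            rw [Finset.sum_congr rfl fun v _ => Finset.sum_comm, Finset.sum_comm]
        _ = _ := by simp [ite_and]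
    rw [this]; exact ht
  have := sum_exp_bilinear_le A hfrob
  rw [← mul_assoc]
  refine le_of_eq_of_le (Finset.sum_congr rfl fun α _ => Finset.sum_congr rfl fun β _ => ?_) this
  congr 1
  simp only [hl, hr, if_true, if_false, hA]
  simp_rw [Finset.mul_sum, Finset.sum_mul]
  rw [Finset.sum_congr rfl fun v _ => Finset.sum_comm, Finset.sum_comm]
  refine Finset.sum_congr rfl fun i _ => ?_
  simp [ite_and, mul_assoc]

/-! ### Discrepancy of the generalized inner product -/

section Discrepancy

variable {F : Type} [Field F] [Fintype F] [DecidableEq F] {r : ℕ}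

/-- `f i` does not depend on the `i`-th argument. -/
def Cylindrical {p : ℕ} {X Y : Type} (i : Fin p) (f : (Fin p → X) → Y) : Prop :=
  ∀ x y, (∀ j, j ≠ i → x j = y j) → f x = f y

/-- The one-coordinate recursion of the discrepancy bound: each duplicated variable adds a chance
`1/q` that the running coefficient vanishes, so `s/q` grows to `(s + 1)/q`. -/
theorem sum_zero_or_const_le (c : F) (s : ℕ) :
    ∑ u : F, (if c * u = 0 then (1 : ℝ) else s / Fintype.card F) ≤
      Fintype.card F * (if c = 0 then 1 else ((s + 1 : ℕ) : ℝ) / Fintype.card F) := by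
  have hq : (0 : ℝ) < Fintype.card F := by exact_mod_cast Fintype.card_pos
  by_cases hc : c = 0
  · simp [hc]
  · simp only [mul_eq_zero, hc, false_or, if_false]
    rw [mul_div_cancel₀ _ hq.ne']
    have h : ∀ u : F, (if u = 0 then (1 : ℝ) else s / Fintype.card F) ≤
        (if u = 0 then 1 else 0) + s / Fintype.card F := by
      intro u
      have : (0 : ℝ) ≤ s / Fintype.card F := by positivity
      split_ifs <;> linarith
    refine (Finset.sum_le_sum fun u _ => h u).trans ?_
    rw [Finset.sum_add_distrib]
    simp only [Finset.sum_ite_eq', Finset.mem_univ, if_true, Finset.sum_const, Finset.card_univ,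
      nsmul_eq_mul]
    rw [mul_div_cancel₀ _ hq.ne']
    push_cast; linarith

omit [Fintype F] [DecidableEq F] in
theorem map_sum_addChar {ι : Type*} (ψ : AddChar F ℂ) (s : Finset ι) (a : ι → F) :
    ψ (∑ i ∈ s, a i) = ∏ i ∈ s, ψ (a i) := by
  classical
  induction s using Finset.induction_on with
  | empty => simp
  | insert i s hi ih => rw [Finset.sum_insert hi, Finset.prod_insert hi, AddChar.map_add_eq_mul, ih]

theorem sum_char_linear (ψ : AddChar F ℂ) (hψ : ψ ≠ 1) (c : Fin r → F) :
    ∑ y : Fin r → F, ψ (∑ j, c j * y j) =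
      (Fintype.card (Fin r → F) : ℂ) * ∏ j, (if c j = 0 then 1 else 0) := by
  simp_rw [map_sum_addChar ψ]
  rw [← Fintype.piFinset_univ, ← Finset.prod_univ_sum (fun _ => Finset.univ)
    (fun j a => ψ (c j * a))]
  have : ∀ j, ∑ a : F, ψ (c j * a) = (Fintype.card F : ℂ) * (if c j = 0 then 1 else 0) := by
    intro j
    have := AddChar.sum_mulShift (c j) (AddChar.IsPrimitive.of_ne_one hψ)
    simp_rw [mul_comm (c j)]
    rw [this]
    split_ifs <;> simp
  simp_rw [this, Finset.prod_mul_distrib]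
  simp

/-- Cauchy–Schwarz removes the bounded factor that does not involve `y`, at the price of duplicating
`y`. -/
theorem norm_sq_sum_le {A Y : Type*} [Fintype A] [Fintype Y] (a : A → ℂ) (ha : ∀ x, ‖a x‖ ≤ 1)
    (g : Y → A → ℂ) :
    ‖∑ y, ∑ x, a x * g y x‖ ^ 2 ≤
      Fintype.card A * ∑ yy : Y × Y, ‖∑ x, g yy.1 x * star (g yy.2 x)‖ := by
  rw [Finset.sum_comm]
  simp_rw [← Finset.mul_sum]
  have h1 : ‖∑ x, a x * ∑ y, g y x‖ ≤ ∑ x, ‖∑ y, g y x‖ := by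
    refine (norm_sum_le _ _).trans (Finset.sum_le_sum fun x _ => ?_)
    rw [norm_mul]
    exact mul_le_of_le_one_left (norm_nonneg _) (ha x)
  have h2 : ((∑ x, ‖∑ y, g y x‖ ^ 2 : ℝ) : ℂ) =
      ∑ yy : Y × Y, ∑ x, g yy.1 x * star (g yy.2 x) := by
    rw [Finset.sum_comm]
    push_cast
    refine Finset.sum_congr rfl fun x _ => ?_
    rw [Fintype.sum_prod_type, ← Complex.mul_conj', map_sum, Finset.sum_mul_sum]
    rfl
  have h3 : (∑ x, ‖∑ y, g y x‖ ^ 2 : ℝ) ≤ ∑ yy : Y × Y, ‖∑ x, g yy.1 x * star (g yy.2 x)‖ := by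
    refine le_trans ?_ (norm_sum_le _ _)
    rw [← h2, Complex.norm_real]
    exact le_abs_self _
  calc _ ≤ (∑ x, ‖∑ y, g y x‖) ^ 2 := by gcongr
    _ ≤ Fintype.card A * ∑ x, ‖∑ y, g y x‖ ^ 2 := sq_sum_le_card_mul_sum_sq
    _ ≤ _ := by gcongr

/-- The discrepancy bound for generalized inner products, with coefficients. -/
theorem norm_sum_cylinder_char_pow_le (ψ : AddChar F ℂ) (hψ : ψ ≠ 1) (s : ℕ) (c : Fin r → F)
    (f : Fin (s + 1) → (Fin (s + 1) → Fin r → F) → ℂ) (hf : ∀ i x, ‖f i x‖ ≤ 1)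
    (hcyl : ∀ i, Cylindrical i (f i)) :
    ‖∑ x : Fin (s + 1) → Fin r → F, (∏ i, f i x) * ψ (∑ j, c j * ∏ i, x i j)‖ ^ 2 ^ s ≤
      ((Fintype.card (Fin r → F) : ℝ) ^ (s + 1)) ^ 2 ^ s *
        ∏ j, (if c j = 0 then 1 else (s : ℝ) / Fintype.card F) := by
  induction s generalizing c with
  | zero =>
    have h0 : ∀ x, f 0 x = f 0 0 := fun x => hcyl 0 x 0 (fun j hj => absurd (Fin.fin_one_eq_zero j) hj)
    simp only [Fin.prod_univ_succ, Fin.prod_univ_zero, mul_one, h0]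
    rw [← Finset.mul_sum, norm_mul, ← (Equiv.funUnique (Fin 1) (Fin r → F)).symm.sum_comp]
    simp only [Equiv.funUnique_symm_apply, uniqueElim_const, Fin.isValue]
    rw [sum_char_linear ψ hψ c]
    simp only [pow_zero, pow_one, norm_mul, norm_prod, zero_add]
    refine (mul_le_of_le_one_left (by positivity) (hf 0 0)).trans (le_of_eq ?_)
    congr 1
    · simp
    · refine Finset.prod_congr rfl fun j _ => ?_
      split_ifs <;> simp
  | succ s ih =>
    set Q : ℝ := (Fintype.card (Fin r → F) : ℝ) with hQ
    set β : ℕ → F → ℝ := fun s a => if a = 0 then 1 else (s : ℝ) / Fintype.card F with hβ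
    -- The argument `0` is split off as `y`. The factor `f 0` ignores it and is the one that
    -- Cauchy–Schwarz eliminates.
    set g : (Fin r → F) → (Fin (s + 1) → Fin r → F) → ℂ := fun y x =>
      (∏ i : Fin (s + 1), f i.succ (Fin.cons y x)) * ψ (∑ j, c j * (y j * ∏ i, x i j)) with hg
    have hsum : ∑ x : Fin (s + 1 + 1) → Fin r → F, (∏ i, f i x) * ψ (∑ j, c j * ∏ i, x i j) =
        ∑ y, ∑ x, f 0 (Fin.cons 0 x) * g y x := by
      rw [← (Fin.consEquiv fun _ : Fin (s + 1 + 1) => (Fin r → F)).sum_comp, Fintype.sum_prod_type]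
      refine Finset.sum_congr rfl fun y _ => Finset.sum_congr rfl fun x _ => ?_
      have : f 0 (Fin.cons y x) = f 0 (Fin.cons 0 x) := by
        refine hcyl 0 _ _ fun j hj => ?_
        obtain ⟨i, rfl⟩ := Fin.exists_succ_eq.2 hj
        simp
      have hc : (Fin.consEquiv fun _ : Fin (s + 1 + 1) => (Fin r → F)) (y, x) = Fin.cons y x := rfl
      simp only [hc, Fin.prod_univ_succ (n := s + 1), this, Fin.cons_zero, Fin.cons_succ, hg]
      ring
    -- For fixed `y, y'` the product with the conjugate is the same kind of sum with one argument
    -- fewer and coefficients `c j * (y j - y' j)`. This is why the induction carries general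
    -- coefficients.
    have hpair : ∀ yy : (Fin r → F) × (Fin r → F),
        ‖∑ x, g yy.1 x * star (g yy.2 x)‖ ^ 2 ^ s ≤
          (Q ^ (s + 1)) ^ 2 ^ s * ∏ j, β s (c j * (yy.1 j - yy.2 j)) := by
      rintro ⟨y, y'⟩
      refine le_of_eq_of_le ?_ (ih (fun j => c j * (y j - y' j))
        (fun i x => f i.succ (Fin.cons y x) * star (f i.succ (Fin.cons y' x))) ?_ ?_)
      · congr 2
        refine Finset.sum_congr rfl fun x _ => ?_
        simp only [hg, star_mul', star_prod, Finset.prod_mul_distrib]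
        have : (∑ j, c j * (y j - y' j) * ∏ i, x i j) =
            (∑ j, c j * (y j * ∏ i, x i j)) + -(∑ j, c j * (y' j * ∏ i, x i j)) := by
          rw [← sub_eq_add_neg, ← Finset.sum_sub_distrib]
          exact Finset.sum_congr rfl fun j _ => by ring
        rw [this, AddChar.map_add_eq_mul, AddChar.map_neg_eq_conj]
        simp only [starRingEnd_apply]
        ring
      · intro i x
        rw [norm_mul, norm_star]
        exact mul_le_one₀ (hf _ _) (norm_nonneg _) (hf _ _)
      · intro i x x' hx
        have : ∀ y : Fin r → F, f i.succ (Fin.cons y x) = f i.succ (Fin.cons y x') := by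
          intro y
          refine hcyl i.succ _ _ fun j hj => ?_
          induction j using Fin.cases with
          | zero => rfl
          | succ j => exact hx j (fun h => hj (h ▸ rfl))
        simp only [this]
    have hcard : (Fintype.card (Fin (s + 1) → Fin r → F) : ℝ) = Q ^ (s + 1) := by
      rw [Fintype.card_fun, Fintype.card_fin]; push_cast; rfl
    have hCS := norm_sq_sum_le (fun x => f 0 (Fin.cons 0 x)) (fun x => hf _ _) g
    rw [hcard] at hCS
    have hJ : (∑ yy : (Fin r → F) × (Fin r → F), ‖∑ x, g yy.1 x * star (g yy.2 x)‖) ^ 2 ^ s ≤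
        (Q ^ 2) ^ (2 ^ s - 1) * ∑ yy : (Fin r → F) × (Fin r → F),
          ‖∑ x, g yy.1 x * star (g yy.2 x)‖ ^ 2 ^ s := by
      have := pow_sum_le_card_mul_sum_pow (s := Finset.univ)
        (f := fun yy : (Fin r → F) × (Fin r → F) => ‖∑ x, g yy.1 x * star (g yy.2 x)‖)
        (fun _ _ => norm_nonneg _) (2 ^ s - 1)
      rw [Nat.sub_add_cancel Nat.one_le_two_pow] at this
      refine this.trans (le_of_eq ?_)
      rw [Finset.card_univ, Fintype.card_prod, Nat.cast_mul, sq]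
    have hβsum : ∑ yy : (Fin r → F) × (Fin r → F), ∏ j, β s (c j * (yy.1 j - yy.2 j)) ≤
        Q ^ 2 * ∏ j, β (s + 1) (c j) := by
      rw [Fintype.sum_prod_type_right]
      simp only
      have : ∀ y' : Fin r → F, ∑ y : Fin r → F, ∏ j, β s (c j * (y j - y' j)) ≤
          Q * ∏ j, β (s + 1) (c j) := by
        intro y'
        rw [Fintype.sum_equiv (Equiv.subRight y') (fun y => ∏ j, β s (c j * (y j - y' j)))
          (fun u => ∏ j, β s (c j * u j)) (fun y => rfl)]
        rw [← Fintype.piFinset_univ, ← Finset.prod_univ_sum (fun _ => Finset.univ)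
          (fun j a => β s (c j * a))]
        calc ∏ j, ∑ a : F, β s (c j * a) ≤ ∏ j, (Fintype.card F * β (s + 1) (c j)) := by
              refine Finset.prod_le_prod (fun j _ => Finset.sum_nonneg fun a _ => ?_)
                fun j _ => sum_zero_or_const_le _ _
              simp only [hβ]; split_ifs <;> positivity
          _ = _ := by
              rw [Finset.prod_mul_distrib, hQ]; simp
      refine (Finset.sum_le_sum fun y' _ => this y').trans (le_of_eq ?_)
      rw [Finset.sum_const, Finset.card_univ, nsmul_eq_mul, sq, mul_assoc]
    rw [hsum, pow_succ' 2 s, pow_mul]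
    calc _ ≤ (Q ^ (s + 1) * ∑ yy : (Fin r → F) × (Fin r → F),
            ‖∑ x, g yy.1 x * star (g yy.2 x)‖) ^ 2 ^ s := by gcongr
      _ ≤ (Q ^ (s + 1)) ^ 2 ^ s * ((Q ^ 2) ^ (2 ^ s - 1) * ((Q ^ (s + 1)) ^ 2 ^ s *
            (Q ^ 2 * ∏ j, β (s + 1) (c j)))) := by
          rw [mul_pow]
          gcongr
          refine hJ.trans ?_
          gcongr
          refine (Finset.sum_le_sum fun yy _ => hpair yy).trans ?_
          rw [← Finset.mul_sum]
          gcongr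
      _ = _ := by
          have h1 : (Q ^ 2) ^ (2 ^ s - 1) * Q ^ 2 = (Q ^ 2) ^ 2 ^ s := by
            rw [← pow_succ, Nat.sub_add_cancel Nat.one_le_two_pow]
          have h2 : (Q ^ (s + 1 + 1)) ^ (2 * 2 ^ s) =
              (Q ^ (s + 1)) ^ 2 ^ s * (Q ^ (s + 1)) ^ 2 ^ s * (Q ^ 2) ^ 2 ^ s := by
            rw [← mul_pow, ← mul_pow, pow_mul]; congr 1; ring
          rw [h2, ← h1]
          ring

/-- With all coefficients `1` the product is `(s/q)^r`; its root of order `2^s` is at most `(s/q)^4`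
because `4 * 2^s ≤ r` and `s ≤ q`. -/
theorem norm_sum_cylinder_char_le (ψ : AddChar F ℂ) (hψ : ψ ≠ 1) (s : ℕ) (hr : 4 * 2 ^ s ≤ r)
    (hs : s ≤ Fintype.card F)
    (f : Fin (s + 1) → (Fin (s + 1) → Fin r → F) → ℂ) (hf : ∀ i x, ‖f i x‖ ≤ 1)
    (hcyl : ∀ i, Cylindrical i (f i)) :
    ‖∑ x : Fin (s + 1) → Fin r → F, (∏ i, f i x) * ψ (GIP x)‖ ≤
      (Fintype.card (Fin r → F) : ℝ) ^ (s + 1) * ((s : ℝ) / Fintype.card F) ^ 4 := by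
  have h := norm_sum_cylinder_char_pow_le ψ hψ s (fun _ : Fin r => 1) f hf hcyl
  simp only [one_mul, one_ne_zero, if_false, Finset.prod_const, Finset.card_univ,
    Fintype.card_fin] at h
  have hq : (0 : ℝ) < Fintype.card F := by exact_mod_cast Fintype.card_pos
  refine le_of_pow_le_pow_left₀ (n := 2 ^ s) (by positivity) (by positivity) (h.trans ?_)
  rw [mul_pow, ← pow_mul _ 4]
  refine mul_le_mul_of_nonneg_left ?_ (by positivity)
  exact pow_le_pow_of_le_one (by positivity) (by rw [div_le_one hq]; exact_mod_cast hs) hr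

/-- On a cylinder intersection the generalized inner product is almost uniform. -/
theorem sum_cylinder_le (s : ℕ) (hr : 4 * 2 ^ s ≤ r) (hs : s ≤ Fintype.card F)
    (C : Fin (s + 1) → (Fin (s + 1) → Fin r → F) → Prop) [∀ x, Decidable (∀ i, C i x)]
    (hcyl : ∀ i, Cylindrical i (C i)) (h : F → ℝ) (H : ℝ) (hH : ∀ w, |h w| ≤ H) :
    ∑ x, (if ∀ i, C i x then h (GIP x) else 0) ≤
      (∑ x, if ∀ i, C i x then (1 : ℝ) else 0) * ((∑ w, h w) / Fintype.card F) +
      (Fintype.card (Fin r → F) : ℝ) ^ (s + 1) *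
        (Fintype.card F * H * ((s : ℝ) / Fintype.card F) ^ 4) := by
  classical
  set q : ℝ := (Fintype.card F : ℝ) with hqdef
  have hq : (0 : ℝ) < q := by rw [hqdef]; exact_mod_cast Fintype.card_pos
  have hH0 : 0 ≤ H := (abs_nonneg _).trans (hH 0)
  set Q : ℝ := (Fintype.card (Fin r → F) : ℝ) ^ (s + 1)
  set f : Fin (s + 1) → (Fin (s + 1) → Fin r → F) → ℂ := fun i x => if C i x then 1 else 0 with hfd
  have hprod : ∀ x, (∏ i, f i x) = if ∀ i, C i x then 1 else 0 := by
    intro x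
    by_cases hx : ∀ i, C i x
    · simp [hfd, hx]
    · rw [if_neg hx]
      push Not at hx
      obtain ⟨i, hi⟩ := hx
      exact Finset.prod_eq_zero (Finset.mem_univ i) (by simp [hfd, hi])
  -- The Fourier contribution of `ψ`. The trivial character gives the main term; each of the at most
  -- `q` others is small by the discrepancy bound.
  set T : AddChar F ℂ → ℂ := fun ψ => (∑ w, (h w : ℂ) * ψ (-w)) * ∑ x, (∏ i, f i x) * ψ (GIP x)
    with hT
  have hfour : (q : ℂ) * ∑ x, (∏ i, f i x) * (h (GIP x) : ℂ) = ∑ ψ, T ψ := by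
    have : ∀ v : F, (q : ℂ) * h v = ∑ ψ : AddChar F ℂ, (∑ w, (h w : ℂ) * ψ (-w)) * ψ v := by
      intro v
      simp_rw [Finset.sum_mul]
      rw [Finset.sum_comm]
      have : ∀ w, ∑ ψ : AddChar F ℂ, (h w : ℂ) * ψ (-w) * ψ v =
          h w * if v = w then (q : ℂ) else 0 := by
        intro w
        have := AddChar.sum_apply_eq_ite (v - w)
        simp only [sub_eq_zero] at this
        rw [hqdef, Complex.ofReal_natCast, ← this, Finset.mul_sum]
        refine Finset.sum_congr rfl fun ψ _ => ?_
        rw [sub_eq_neg_add, AddChar.map_add_eq_mul, mul_assoc]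
      simp_rw [this]
      simp [mul_comm]
    rw [Finset.mul_sum]
    simp_rw [hT, Finset.mul_sum]
    rw [Finset.sum_comm]
    refine Finset.sum_congr rfl fun x _ => ?_
    rw [mul_left_comm, this, Finset.mul_sum]
    exact Finset.sum_congr rfl fun ψ _ => by ring
  have hone : T 1 = ((∑ w, h w : ℝ) : ℂ) * ((∑ x, if ∀ i, C i x then (1 : ℝ) else 0 : ℝ) : ℂ) := by
    rw [hT]
    simp only [AddChar.one_apply, mul_one, hprod]
    push_cast
    congr 1
    exact Finset.sum_congr rfl fun x _ => by split_ifs <;> simp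
  have hbound : ∀ ψ ∈ Finset.univ.erase (1 : AddChar F ℂ), ‖T ψ‖ ≤ q * H * (Q * (s / q) ^ 4) := by
    intro ψ hψ
    rw [hT]
    simp only [norm_mul]
    gcongr
    · refine (norm_sum_le _ _).trans ?_
      calc _ ≤ ∑ _w : F, H := Finset.sum_le_sum fun w _ => by
            rw [norm_mul, AddChar.norm_apply, mul_one, Complex.norm_real]; exact hH w
        _ = q * H := by simp [hqdef]
    · refine norm_sum_cylinder_char_le ψ (Finset.ne_of_mem_erase hψ) s hr hs f ?_ ?_
      · intro i x; simp only [hfd]; split_ifs <;> simp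
      · intro i x y hxy
        simp only [hfd, hcyl i x y hxy]
  have hcardψ : ((Finset.univ.erase (1 : AddChar F ℂ)).card : ℝ) ≤ q := by
    have h1 : (Finset.univ.erase (1 : AddChar F ℂ)).card ≤ Fintype.card (AddChar F ℂ) :=
      Finset.card_le_univ _
    rw [AddChar.card_eq] at h1
    rw [hqdef]
    exact_mod_cast h1
  have hre : q * ∑ x, (if ∀ i, C i x then h (GIP x) else 0) -
      (∑ w, h w) * (∑ x, if ∀ i, C i x then (1 : ℝ) else 0) ≤ q * (q * H * (Q * (s / q) ^ 4)) := by
    have hc : ((q * ∑ x, (if ∀ i, C i x then h (GIP x) else 0) -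
      (∑ w, h w) * (∑ x, if ∀ i, C i x then (1 : ℝ) else 0) : ℝ) : ℂ) =
        ∑ ψ ∈ Finset.univ.erase (1 : AddChar F ℂ), T ψ := by
      rw [← Finset.add_sum_erase _ _ (Finset.mem_univ (1 : AddChar F ℂ)), hone] at hfour
      rw [Complex.ofReal_sub, Complex.ofReal_mul, Complex.ofReal_mul, sub_eq_iff_eq_add', ← hfour]
      congr 1
      push_cast
      refine Finset.sum_congr rfl fun x _ => ?_
      rw [hprod]
      split_ifs <;> simp
    calc _ ≤ ‖((q * ∑ x, (if ∀ i, C i x then h (GIP x) else 0) -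
      (∑ w, h w) * (∑ x, if ∀ i, C i x then (1 : ℝ) else 0) : ℝ) : ℂ)‖ := by
          rw [Complex.norm_real]; exact le_abs_self _
      _ ≤ ∑ ψ ∈ Finset.univ.erase (1 : AddChar F ℂ), ‖T ψ‖ := by
          rw [hc]; exact norm_sum_le _ _
      _ ≤ _ := by
          refine (Finset.sum_le_card_nsmul _ _ _ hbound).trans ?_
          rw [nsmul_eq_mul]
          gcongr
  refine le_of_mul_le_mul_left ?_ hq
  rw [mul_add]
  have : q * ((∑ x, if ∀ i, C i x then (1 : ℝ) else 0) * ((∑ w, h w) / q)) =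
      (∑ w, h w) * (∑ x, if ∀ i, C i x then (1 : ℝ) else 0) := by
    field_simp
  rw [this]
  linarith [hre, show q * (q * H * (Q * (s / q) ^ 4)) = q * (Q * (q * H * (s / q) ^ 4)) by ring]

end Discrepancy

/-! ### Counting transcripts -/

section Strings

/-- The bit strings of length at most `c`. -/
def stringsUpTo (c : ℕ) : Finset (List Bool) :=
  ((Finset.range (c + 1)).sigma fun n => (Finset.univ : Finset (Fin n → Bool))).map
    List.equivSigmaTuple.symm.toEmbedding

theorem mem_stringsUpTo {c : ℕ} {l : List Bool} : l ∈ stringsUpTo c ↔ l.length ≤ c := by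
  simp only [stringsUpTo, Finset.mem_map_equiv, Equiv.symm_symm, Finset.mem_sigma,
    Finset.mem_range, Finset.mem_univ, and_true]
  exact Nat.lt_succ_iff

/-- The messages need not be prefix-free, so the weight is `4^(-length)` instead of `2^(-length)`:
the strings of length `n` contribute `2^(-n)`. The weight is multiplicative, hence also counts
tuples by total length. -/
theorem sum_stringsUpTo_le (c : ℕ) :
    ∑ l ∈ stringsUpTo c, ((1 : ℝ) / 4) ^ l.length ≤ 2 := by
  have h : ∀ n, ∑ f : Fin n → Bool, ((1 : ℝ) / 4) ^ (List.ofFn f).length = (1 / 2) ^ n := by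
    intro n
    simp only [List.length_ofFn, Finset.sum_const, Finset.card_univ, Fintype.card_fun,
      Fintype.card_bool, Fintype.card_fin, nsmul_eq_mul]
    push_cast
    rw [← mul_pow]; norm_num
  rw [stringsUpTo, Finset.sum_map, Finset.sum_sigma]
  calc _ = ∑ n ∈ Finset.range (c + 1), ((1 : ℝ) / 2) ^ n := Finset.sum_congr rfl fun n _ => h n
    _ ≤ 2 := sum_geometric_two_le _

theorem card_stringsUpTo_le (c : ℕ) : ((stringsUpTo c).card : ℝ) ≤ 2 * 4 ^ c := by
  have h : ∑ l ∈ stringsUpTo c, ((1 : ℝ) / 4) ^ c ≤ 2 := by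
    refine le_trans (Finset.sum_le_sum fun l hl => ?_) (sum_stringsUpTo_le c)
    exact pow_le_pow_of_le_one (by norm_num) (by norm_num) (mem_stringsUpTo.1 hl)
  rw [Finset.sum_const, nsmul_eq_mul, div_pow, one_pow, mul_one_div,
    div_le_iff₀ (by positivity)] at h
  exact h

/-- The tuples of bit strings of total length at most `c`. -/
def transcriptsUpTo (p c : ℕ) : Finset (Fin p → List Bool) :=
  (Fintype.piFinset fun _ => stringsUpTo c).filter fun t => ∑ i, (t i).length ≤ c

theorem mem_transcriptsUpTo {p c : ℕ} {t : Fin p → List Bool} :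
    t ∈ transcriptsUpTo p c ↔ ∑ i, (t i).length ≤ c := by
  simp only [transcriptsUpTo, Finset.mem_filter, Fintype.mem_piFinset, mem_stringsUpTo,
    and_iff_right_iff_imp]
  intro h i
  exact (Finset.single_le_sum (f := fun i => (t i).length) (fun _ _ => Nat.zero_le _)
    (Finset.mem_univ i)).trans h

theorem card_transcriptsUpTo_le (p c : ℕ) :
    ((transcriptsUpTo p c).card : ℝ) ≤ 2 ^ p * 4 ^ c := by
  have h : ∑ t ∈ transcriptsUpTo p c, ((1 : ℝ) / 4) ^ c ≤ 2 ^ p := by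
    calc _ ≤ ∑ t ∈ transcriptsUpTo p c, ∏ i, ((1 : ℝ) / 4) ^ (t i).length := by
          refine Finset.sum_le_sum fun t ht => ?_
          rw [Finset.prod_pow_eq_pow_sum]
          exact pow_le_pow_of_le_one (by norm_num) (by norm_num) (mem_transcriptsUpTo.1 ht)
      _ ≤ ∑ t ∈ Fintype.piFinset fun _ : Fin p => stringsUpTo c,
            ∏ i, ((1 : ℝ) / 4) ^ (t i).length :=
          Finset.sum_le_sum_of_subset_of_nonneg (Finset.filter_subset _ _)
            fun t _ _ => by positivity
      _ = ∏ _i : Fin p, ∑ l ∈ stringsUpTo c, ((1 : ℝ) / 4) ^ l.length := by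
          rw [Finset.prod_univ_sum]
      _ ≤ ∏ _i : Fin p, (2 : ℝ) :=
          Finset.prod_le_prod (fun _ _ => Finset.sum_nonneg fun _ _ => by positivity)
            fun _ _ => sum_stringsUpTo_le c
      _ = 2 ^ p := by simp
  rw [Finset.sum_const, nsmul_eq_mul, div_pow, one_pow, mul_one_div,
    div_le_iff₀ (by positivity)] at h
  exact h

attribute [irreducible] stringsUpTo transcriptsUpTo

end Strings

/-! ### Cylinder intersections of a one-way protocol -/

section Cylinders

variable {k m L : ℕ}

/-- The input with matching index `i` and gadget input `y`. -/
def mkInput (i : Fin m) (y : Fin (k - 1) → Fin L → Bool) : (j : Fin k) → HMInput k m L j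
  | ⟨0, _⟩ => i
  | ⟨s + 1, h⟩ => y ⟨s, by omega⟩

theorem mkInput_congr (i : Fin m) {y y' : Fin (k - 1) → Fin L → Bool} {s : Fin (k - 1)}
    (h : ∀ j, j ≠ s → y j = y' j) {j : Fin k} (hj : j.val ≠ s.val + 1) :
    mkInput i y j = mkInput i y' j := by
  obtain ⟨j, hjk⟩ := j
  cases j with
  | zero => rfl
  | succ j =>
    exact h ⟨j, by omega⟩ fun h' => hj (by rw [← h'])

variable [NeZero k]

variable {Z : Type}

/-- Given the transcript `t` and the answer `o`, the player that does not see `y s` behaves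
accordingly on the input `(i, y)`. -/
def Consistent (P : DetProtocol (HMInput k m L) Z) (i : Fin m) (s : Fin (k - 1))
    (t : Fin (k - 1) → List Bool) (o : Z) (y : Fin (k - 1) → Fin L → Bool) : Prop :=
  -- The string `y s` is on the forehead of player `s + 1`, counted from `0`; for `s = k - 2` this
  -- is the last player. No `s` tests message `0`, which has to be fixed separately.
  if h : s.val + 1 < k - 1 then
    P.msg ⟨s.val + 1, h⟩ (view (mkInput i y) (sender ⟨s.val + 1, h⟩)) (fun j _ => t j) =
      t ⟨s.val + 1, h⟩
  else P.out (view (mkInput i y) (lastPlayer k)) t = o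

omit [NeZero k] in
theorem view_mkInput_congr (i : Fin m) {y y' : Fin (k - 1) → Fin L → Bool} {s : Fin (k - 1)}
    (h : ∀ j, j ≠ s → y j = y' j) {a : Fin k} (ha : a.val = s.val + 1) :
    view (mkInput i y) a = view (mkInput i y') a := by
  funext j hj
  exact mkInput_congr i h fun h' => hj (Fin.ext (h'.trans ha.symm))

theorem Consistent.cylindrical (P : DetProtocol (HMInput k m L) Z) (i : Fin m) (s : Fin (k - 1))
    (t : Fin (k - 1) → List Bool) (o : Z) : Cylindrical s (Consistent P i s t o) := by
  intro y y' h
  unfold Consistent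
  split_ifs with hs
  · rw [view_mkInput_congr i h (a := sender ⟨s.val + 1, hs⟩) rfl]
  · rw [view_mkInput_congr i h (a := lastPlayer k)]
    have := s.isLt
    simp only [lastPlayer]
    omega

theorem consistent_transcript (P : DetProtocol (HMInput k m L) Z) (i : Fin m) (s : Fin (k - 1))
    (y : Fin (k - 1) → Fin L → Bool) :
    Consistent P i s (P.transcript (mkInput i y)) (P.output (mkInput i y)) y := by
  unfold Consistent
  split_ifs with hs
  · conv_rhs => rw [DetProtocol.transcript]
  · rfl

/-- Once message `0` is known, consistency determines the later messages one after another, then the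
answer. This makes the cylinder intersections for one first message disjoint. -/
theorem Consistent.unique (hk : 2 ≤ k) (P : DetProtocol (HMInput k m L) Z) (i : Fin m)
    {t t' : Fin (k - 1) → List Bool} {o o' : Z} {y : Fin (k - 1) → Fin L → Bool}
    (h0 : t ⟨0, by omega⟩ = t' ⟨0, by omega⟩) (h : ∀ s, Consistent P i s t o y)
    (h' : ∀ s, Consistent P i s t' o' y) : t = t' ∧ o = o' := by
  have key : ∀ n (hn : n < k - 1), t ⟨n, hn⟩ = t' ⟨n, hn⟩ := by
    intro n
    induction n using Nat.strong_induction_on with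
    | _ n ih =>
      intro hn
      cases n with
      | zero => exact h0
      | succ n =>
        have h1 := h ⟨n, by omega⟩
        have h2 := h' ⟨n, by omega⟩
        unfold Consistent at h1 h2
        rw [dif_pos hn] at h1 h2
        rw [← h1, ← h2]
        congr 1
        funext j hj
        exact ih j.val hj j.isLt
  have ht : t = t' := funext fun j => key j.val j.isLt
  refine ⟨ht, ?_⟩
  have h1 := h ⟨k - 2, by omega⟩
  have h2 := h' ⟨k - 2, by omega⟩
  unfold Consistent at h1 h2
  have hn : ¬ (k - 2 + 1 < k - 1) := by omega
  rw [dif_neg hn] at h1 h2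
  rw [← h1, ← h2, ht]

variable [Fintype Z]

open Classical in
/-- A one-way protocol that runs on all matching indices in parallel reduces, for each message of
the first player, to a partition into few cylinder intersections on which all answers are fixed. -/
theorem sum_outputs_le (hk : 2 ≤ k) (P : DetProtocol (HMInput k m L) Z) {c : ℕ}
    (hc : ∀ x, P.bits x ≤ c) {W : Type} (G : (Fin (k - 1) → Fin L → Bool) → W)
    (h : (Fin m → Z) → W → ℝ) (h0 : ∀ o w, 0 ≤ h o w) (α κ : ℝ) (hα : 0 ≤ α) (hκ : 0 ≤ κ)
    (hcyl : ∀ (o : Fin m → Z) (C : Fin (k - 1) → (Fin (k - 1) → Fin L → Bool) → Prop)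
      [∀ y, Decidable (∀ s, C s y)], (∀ s, Cylindrical s (C s)) → ∑ y, (if ∀ s, C s y then h o (G y) else 0) ≤
        (∑ y, if ∀ s, C s y then (1 : ℝ) else 0) * α + κ) :
    ∑ y, h (fun i => P.output (mkInput i y)) (G y) ≤
      2 * 4 ^ c * (Fintype.card (Fin (k - 1) → Fin L → Bool) * α +
        (2 ^ (k - 1) * 4 ^ c * Fintype.card Z : ℝ) ^ m * κ) := by
  have hk0 : 0 < k - 1 := by omega
  set Φ : Finset (Fin m → (Fin (k - 1) → List Bool) × Z) :=
    Fintype.piFinset fun _ => transcriptsUpTo (k - 1) c ×ˢ Finset.univ with hΦ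
  -- Fixing a common first message `a` for all indices costs a factor counting single strings, not
  -- `m`-tuples of them. This is where one-way communication helps.
  set fam : List Bool → Finset (Fin m → (Fin (k - 1) → List Bool) × Z) := fun a =>
    Φ.filter fun φ => ∀ i, (φ i).1 ⟨0, hk0⟩ = a with hfam
  set C : (Fin m → (Fin (k - 1) → List Bool) × Z) → Fin (k - 1) →
      (Fin (k - 1) → Fin L → Bool) → Prop := fun φ s y =>
    ∀ i, Consistent P i s (φ i).1 (φ i).2 y with hC
  have hCcyl : ∀ φ s, Cylindrical s (C φ s) := by
    intro φ s y y' hy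
    have : ∀ i, Consistent P i s (φ i).1 (φ i).2 y = Consistent P i s (φ i).1 (φ i).2 y' :=
      fun i => Consistent.cylindrical P i s _ _ y y' hy
    simp only [hC, this]
  have hΦcard : (Φ.card : ℝ) ≤ (2 ^ (k - 1) * 4 ^ c * Fintype.card Z : ℝ) ^ m := by
    rw [hΦ, Fintype.card_piFinset]
    simp only [Finset.card_product, Finset.prod_const, Finset.card_univ, Fintype.card_fin]
    push_cast
    gcongr
    exact card_transcriptsUpTo_le _ _
  have hdisj : ∀ a, ∑ φ ∈ fam a, ∑ y, (if ∀ s, C φ s y then (1 : ℝ) else 0) ≤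
      Fintype.card (Fin (k - 1) → Fin L → Bool) := by
    intro a
    rw [Finset.sum_comm]
    calc _ ≤ ∑ _y : Fin (k - 1) → Fin L → Bool, (1 : ℝ) := by
          refine Finset.sum_le_sum fun y _ => ?_
          rw [Finset.sum_boole]
          have : ((fam a).filter fun φ => ∀ s, C φ s y).card ≤ 1 := by
            rw [Finset.card_le_one]
            intro φ hφ φ' hφ'
            simp only [Finset.mem_filter, hfam] at hφ hφ'
            funext i
            have := Consistent.unique hk P i ((hφ.1.2 i).trans (hφ'.1.2 i).symm)
              (fun s => hφ.2 s i) (fun s => hφ'.2 s i)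
            exact Prod.ext this.1 this.2
          exact_mod_cast this
      _ = _ := by simp
  have hcover : ∀ y, h (fun i => P.output (mkInput i y)) (G y) ≤
      ∑ a ∈ stringsUpTo c, ∑ φ ∈ fam a,
        if ∀ s, C φ s y then h (fun i => (φ i).2) (G y) else 0 := by
    intro y
    have hnn : ∀ φ : Fin m → (Fin (k - 1) → List Bool) × Z,
        0 ≤ if ∀ s, C φ s y then h (fun i => (φ i).2) (G y) else 0 := by
      intro φ; split_ifs
      · exact h0 _ _
      · exact le_rfl
    set φ : Fin m → (Fin (k - 1) → List Bool) × Z := fun i =>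
      (P.transcript (mkInput i y), P.output (mkInput i y)) with hφ
    have hφC : ∀ s, C φ s y := fun s i => consistent_transcript P i s y
    have hφΦ : φ ∈ Φ := by
      rw [hΦ, Fintype.mem_piFinset]
      intro i
      rw [Finset.mem_product]
      exact ⟨mem_transcriptsUpTo.2 (hc _), Finset.mem_univ _⟩
    -- The first player does not see the matching index, so its message is the same for all `i`.
    obtain ⟨a, ha, hφa⟩ : ∃ a ∈ stringsUpTo c, ∀ i, (φ i).1 ⟨0, hk0⟩ = a := by
      rcases isEmpty_or_nonempty (Fin m) with hm | ⟨⟨i₀⟩⟩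
      · exact ⟨[], mem_stringsUpTo.2 (Nat.zero_le _), fun i => hm.elim i⟩
      · refine ⟨(φ i₀).1 ⟨0, hk0⟩, mem_stringsUpTo.2 ?_, fun i => ?_⟩
        · exact (Finset.single_le_sum (f := fun j => ((φ i₀).1 j).length)
            (fun _ _ => Nat.zero_le _) (Finset.mem_univ _)).trans (hc (mkInput i₀ y))
        · simp only [hφ]
          rw [DetProtocol.transcript, DetProtocol.transcript]
          congr 1
          · funext j hj
            obtain ⟨j, hjk⟩ := j
            cases j with
            | zero => exact absurd rfl hj
            | succ j => rfl
          · funext j hj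
            exact absurd hj (Nat.not_lt_zero _)
    have hmem : φ ∈ fam a := Finset.mem_filter.2 ⟨hφΦ, hφa⟩
    calc _ = if ∀ s, C φ s y then h (fun i => (φ i).2) (G y) else 0 := by rw [if_pos hφC]
      _ ≤ _ := Finset.single_le_sum (f := fun φ => if ∀ s, C φ s y then
            h (fun i => (φ i).2) (G y) else 0) (fun φ _ => hnn φ) hmem
      _ ≤ _ := Finset.single_le_sum (f := fun a => ∑ φ ∈ fam a, if ∀ s, C φ s y then
            h (fun i => (φ i).2) (G y) else 0)
            (fun a _ => Finset.sum_nonneg fun φ _ => hnn φ) ha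
  set B : ℝ := Fintype.card (Fin (k - 1) → Fin L → Bool) * α +
        (2 ^ (k - 1) * 4 ^ c * Fintype.card Z : ℝ) ^ m * κ with hB
  have hB0 : 0 ≤ B := by positivity
  calc _ ≤ ∑ y, ∑ a ∈ stringsUpTo c, ∑ φ ∈ fam a,
        (if ∀ s, C φ s y then h (fun i => (φ i).2) (G y) else 0) :=
        Finset.sum_le_sum fun y _ => hcover y
    _ = ∑ a ∈ stringsUpTo c, ∑ φ ∈ fam a, ∑ y,
        (if ∀ s, C φ s y then h (fun i => (φ i).2) (G y) else 0) := by
        rw [Finset.sum_comm]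
        exact Finset.sum_congr rfl fun a _ => Finset.sum_comm
    _ ≤ ∑ a ∈ stringsUpTo c, B := by
        refine Finset.sum_le_sum fun a _ => ?_
        calc _ ≤ ∑ φ ∈ fam a, ((∑ y, if ∀ s, C φ s y then (1 : ℝ) else 0) * α + κ) :=
              Finset.sum_le_sum fun φ _ => hcyl _ _ (hCcyl φ)
          _ = (∑ φ ∈ fam a, ∑ y, if ∀ s, C φ s y then (1 : ℝ) else 0) * α +
                (fam a).card * κ := by
              rw [Finset.sum_add_distrib, Finset.sum_mul, Finset.sum_const, nsmul_eq_mul]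
          _ ≤ B := by
              rw [hB]
              gcongr
              · exact hdisj a
              · refine le_trans ?_ hΦcard
                exact_mod_cast Finset.card_le_card (Finset.filter_subset _ _)
    _ ≤ _ := by
        rw [Finset.sum_const, nsmul_eq_mul]
        gcongr
        exact card_stringsUpTo_le c

end Cylinders

/-! ### From vectors over the field to bit strings -/

section Gadget

variable {F : Type} {N : ℕ}

/-- Reading a bit string as a vector is a bijection. -/
def decodeEquiv (e : F ≃ (Fin N → Bool)) (r : ℕ) : (Fin (r * N) → Bool) ≃ (Fin r → F) where
  toFun := decode e
  invFun x := fun b => e (x (finProdFinEquiv.symm b).1) (finProdFinEquiv.symm b).2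
  left_inv y := by
    funext b
    simp only [decode, Equiv.apply_symm_apply, Prod.mk.eta]
  right_inv x := by
    funext j
    simp [decode]

variable [Field F]

theorem sum_cylinder_bits_le [Fintype F] (e : F ≃ (Fin N → Bool)) {p r : ℕ} (hp : 0 < p)
    (hr : 2 ^ (p + 1) ≤ r) (hpq : p ≤ Fintype.card F)
    (C : Fin p → (Fin p → Fin (r * N) → Bool) → Prop) [∀ y, Decidable (∀ s, C s y)]
    (hcyl : ∀ s, Cylindrical s (C s)) (h : F → ℝ) (H : ℝ) (hH : ∀ w, |h w| ≤ H) :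
    ∑ y, (if ∀ s, C s y then h (GIP fun i => decode e (y i)) else 0) ≤
      (∑ y, if ∀ s, C s y then (1 : ℝ) else 0) * ((∑ w, h w) / Fintype.card F) +
      Fintype.card (Fin p → Fin (r * N) → Bool) *
        (Fintype.card F * H * ((p : ℝ) / Fintype.card F) ^ 4) := by
  classical
  obtain ⟨s, rfl⟩ : ∃ s, p = s + 1 := ⟨p - 1, by omega⟩
  have hH0 : 0 ≤ H := (abs_nonneg _).trans (hH 0)
  let D : (Fin (s + 1) → Fin (r * N) → Bool) ≃ (Fin (s + 1) → Fin r → F) :=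
    Equiv.piCongrRight fun _ => decodeEquiv e r
  have hcyl' : ∀ i, Cylindrical i fun x => C i (D.symm x) := by
    intro i x x' hx
    refine hcyl i _ _ fun j hj => ?_
    simp only [D, Equiv.piCongrRight_symm_apply, Pi.map_apply]
    rw [hx j hj]
  -- With `p = s + 1` the hypothesis `2^(p + 1) ≤ r` is exactly `4 * 2^s ≤ r`.
  have key := sum_cylinder_le s (by rw [pow_add, pow_add] at hr; omega) (by omega)
    (fun i x => C i (D.symm x)) hcyl' h H hH
  have hQ : (Fintype.card (Fin (s + 1) → Fin (r * N) → Bool) : ℝ) =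
      (Fintype.card (Fin r → F) : ℝ) ^ (s + 1) := by
    rw [Fintype.card_congr D, Fintype.card_fun (α := Fin (s + 1)), Fintype.card_fin]
    push_cast; rfl
  rw [hQ]
  have h1 : ∑ x, (if ∀ i, C i (D.symm x) then h (GIP x) else 0) =
      ∑ y, (if ∀ s, C s y then h (GIP fun i => decode e (y i)) else 0) := by
    rw [← D.sum_comp]
    exact Finset.sum_congr rfl fun y _ => by simp only [Equiv.symm_apply_apply]; rfl
  have h2 : ∑ x, (if ∀ i, C i (D.symm x) then (1 : ℝ) else 0) =
      ∑ y, (if ∀ s, C s y then (1 : ℝ) else 0) := by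
    rw [← D.sum_comp]
    exact Finset.sum_congr rfl fun y _ => by simp only [Equiv.symm_apply_apply]
  rw [h1, h2] at key
  refine key.trans ?_
  gcongr
  linarith

end Gadget

/-! ### Scores of answers and their exponential moment -/

section Score

variable {m N : ℕ}

open Classical in
/-- `1` if the answer `z` is valid for the matching index `i` and the gadget value `g`, otherwise
`-1`. -/
noncomputable def score (i : Fin m) (z : Fin (2 * m) × Fin (2 * m) × Bool) (g : Fin (2 * m) → Bool) : ℝ :=
  if (z.1, z.2.1) ∈ matching m i ∧ z.2.2 = xor (g z.1) (g z.2.1) then 1 else -1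

theorem abs_score (i : Fin m) (z : Fin (2 * m) × Fin (2 * m) × Bool) (g : Fin (2 * m) → Bool) :
    |score i z g| = 1 := by
  unfold score; split_ifs <;> simp

theorem sgn_sq (b : Bool) : sgn b ^ 2 = 1 := by cases b <;> simp [sgn]

theorem neg_one_le_sgn (a b c : Bool) : -1 ≤ sgn a * (sgn b * sgn c) := by
  cases a <;> cases b <;> cases c <;> norm_num [sgn]

/-- The right endpoint of the edge of the `i`-th matching with left endpoint `l`. -/
def partner (i l : Fin m) : Fin (2 * m) :=
  ⟨m + (i.val + l.val) % m, by
    have := Nat.mod_lt (i.val + l.val) (Nat.zero_lt_of_lt i.isLt); omega⟩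

/-- The left endpoint `l`, as a position. -/
def leftPos (l : Fin m) : Fin (2 * m) := ⟨l.val, by omega⟩

theorem mem_matching_iff {i : Fin m} {p : Fin (2 * m) × Fin (2 * m)} :
    p ∈ matching m i ↔ ∃ l, p = (leftPos l, partner i l) := by
  simp only [matching, Set.mem_ofPred_eq, Prod.ext_iff, Fin.ext_iff, leftPos, partner]

theorem partner_left_injective (l : Fin m) : Function.Injective fun i => partner i l := by
  intro i i' h
  simp only [partner, Fin.mk.injEq, Nat.add_left_cancel_iff] at h
  have : i.val ≡ i'.val [MOD m] := Nat.ModEq.add_right_cancel' l.val h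
  rw [Nat.ModEq, Nat.mod_eq_of_lt i.isLt, Nat.mod_eq_of_lt i'.isLt] at this
  exact Fin.ext this

/-- An answer that names an edge scores its signed parity. Any other answer scores `-1`, which every
signed parity dominates, so one may assume that all answers name edges. -/
theorem exists_score_le (i : Fin m) (z : Fin (2 * m) × Fin (2 * m) × Bool) :
    ∃ (l : Fin m) (b : Bool), ∀ g,
      score i z g ≤ sgn b * (sgn (g (leftPos l)) * sgn (g (partner i l))) := by
  by_cases hz : (z.1, z.2.1) ∈ matching m i
  · obtain ⟨l, hl⟩ := mem_matching_iff.1 hz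
    refine ⟨l, z.2.2, fun g => ?_⟩
    simp only [Prod.mk.injEq] at hl
    unfold score
    rw [← hl.1, ← hl.2]
    by_cases h : z.2.2 = xor (g z.1) (g z.2.1)
    · rw [if_pos ⟨hz, h⟩, h]
      cases g z.1 <;> cases g z.2.1 <;> norm_num [sgn]
    · rw [if_neg fun h' => h h'.2]
      exact neg_one_le_sgn _ _ _
  · refine ⟨i, false, fun g => ?_⟩
    unfold score
    rw [if_neg fun h => hz h.1]
    exact neg_one_le_sgn _ _ _

theorem sum_exp_score_le (hmN : 2 * m ≤ N) (hm : 0 < m)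
    (o : Fin m → Fin (2 * m) × Fin (2 * m) × Bool) :
    ∑ y : Fin N → Bool,
      Real.exp (1 / √(2 * m) * ∑ i, score i (o i) fun t => y (Fin.castLE hmN t)) ≤
      2 ^ N * √2 := by
  choose l b hlb using fun i => exists_score_le i (o i)
  have hm' : (0 : ℝ) < m := by exact_mod_cast hm
  -- The edges join the positions below `m` to the others. They are distinct because different
  -- matchings give a left endpoint different partners. Here `λ² * m = 1/2` is the largest value
  -- allowed.
  have key := sum_exp_parity_le (fun u : Fin N => u.val < m)
    (fun i => Fin.castLE hmN (leftPos (l i))) (fun i => Fin.castLE hmN (partner i (l i)))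
    (fun i => (l i).isLt) (fun i => by simp [partner]) (by
      intro i i' h
      simp only [Prod.mk.injEq, Fin.castLE_inj] at h
      have hl : l i = l i' := by
        have := h.1; simp only [leftPos, Fin.mk.injEq] at this; exact Fin.ext this
      rw [hl] at h
      exact partner_left_injective _ h.2)
    (fun i => sgn (b i)) (fun i => sgn_sq _) (1 / √(2 * m)) (by
      rw [div_pow, Real.sq_sqrt (by positivity), Fintype.card_fin]
      apply le_of_eq; field_simp)
  rw [Fintype.card_fin] at key
  refine le_trans (Finset.sum_le_sum fun y _ => ?_) key
  gcongr with i
  exact hlb i _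

end Score

/-! ### Fixing the randomness and comparing exponential moments -/

/-- Some outcome is no worse than the average. The bad events are not assumed measurable, so the
averaging is done on their measurable hulls. -/
theorem exists_card_le {Ω : Type*} [MeasurableSpace Ω] (μ : Measure Ω) [IsProbabilityMeasure μ]
    {X : Type*} [Fintype X] (bad : X → Set Ω) (δ : ℝ) (hδ : 0 ≤ δ)
    (h : ∀ x, μ (bad x) ≤ ENNReal.ofReal δ) :
    ∃ ω, ∑ x, (bad x).indicator (fun _ => (1 : ℝ)) ω ≤ δ * Fintype.card X := by
  classical
  set f : Ω → ENNReal := fun ω => ∑ x, (toMeasurable μ (bad x)).indicator (fun _ => 1) ω with hf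
  have hfm : Measurable f := Finset.measurable_fun_sum _ fun x _ =>
    measurable_const.indicator (measurableSet_toMeasurable _ _)
  obtain ⟨ω, hω⟩ := exists_le_lintegral (μ := μ) hfm.aemeasurable
  have hint : ∫⁻ ω, f ω ∂μ ≤ ENNReal.ofReal (δ * Fintype.card X) := by
    rw [hf, lintegral_finsetSum _ fun x _ =>
      measurable_const.indicator (measurableSet_toMeasurable _ _)]
    calc _ ≤ ∑ _x : X, ENNReal.ofReal δ := by
          refine Finset.sum_le_sum fun x _ => ?_
          rw [lintegral_indicator (measurableSet_toMeasurable _ _)]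
          simpa using h x
      _ = _ := by
          rw [Finset.sum_const, nsmul_eq_mul, mul_comm δ, ENNReal.ofReal_mul (by positivity),
            ENNReal.ofReal_natCast, Finset.card_univ]
  refine ⟨ω, ?_⟩
  have h1 : ENNReal.ofReal (∑ x, (bad x).indicator (fun _ => (1 : ℝ)) ω) ≤ f ω := by
    rw [ENNReal.ofReal_sum_of_nonneg fun x _ => Set.indicator_nonneg (fun _ _ => zero_le_one) _]
    refine Finset.sum_le_sum fun x _ => ?_
    by_cases hx : ω ∈ bad x
    · rw [Set.indicator_of_mem hx, Set.indicator_of_mem (subset_toMeasurable _ _ hx)]; simp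
    · rw [Set.indicator_of_notMem hx]; simp
  exact (ENNReal.ofReal_le_ofReal_iff (by positivity)).1 (h1.trans (hω.trans hint))

section Bound

variable {F : Type} [Field F] {N k r : ℕ} [NeZero k]

/-- Both sides estimate the mean over `y` of `exp(λ * total score)`: from below by the success
probability, from above by the partition into cylinder intersections. -/
theorem exp_le_of_protocol (e : F ≃ (Fin N → Bool)) (hk : 2 ≤ k) (hkN : 2 ^ k ≤ N)
    (hr : 2 ^ k ≤ r) (hm : 0 < numMatchings N) (δ : ℝ) (hδ : 0 ≤ δ) {Ω : Type} [MeasurableSpace Ω]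
    (μ : Measure Ω) [IsProbabilityMeasure μ]
    (P : Ω → DetProtocol (HMInput k (numMatchings N) (r * N))
      (Fin (2 * numMatchings N) × Fin (2 * numMatchings N) × Bool)) (c : ℕ)
    (herr : ∀ x, μ {ω | ¬ liftedHM (gadget e k r) x ((P ω).output x)} ≤ ENNReal.ofReal δ)
    (hc : ∀ ω x, (P ω).bits x ≤ c) :
    Real.exp ((1 - 2 * δ) * √(numMatchings N / 2)) ≤
      2 * 4 ^ c * (√2 + (2 ^ (k - 1) * 4 ^ c * (8 * (numMatchings N : ℝ) ^ 2)) ^ numMatchings N *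
        (2 ^ N * Real.exp √(numMatchings N / 2) * ((k : ℝ) / 2 ^ N) ^ 4)) := by
  classical
  let : Fintype F := Fintype.ofEquiv _ e.symm
  have hcard : Fintype.card F = 2 ^ N := by
    rw [Fintype.card_congr e]; simp
  have hm' : (0 : ℝ) < numMatchings N := by exact_mod_cast hm
  set lam : ℝ := 1 / √(2 * numMatchings N) with hlam
  have hlam0 : 0 ≤ lam := by positivity
  have hlamm : lam * numMatchings N = √((numMatchings N : ℝ) / 2) := by
    rw [hlam, one_div_mul_eq_div, div_eq_iff (by positivity), ← Real.sqrt_mul (by positivity)]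
    rw [show (numMatchings N : ℝ) / 2 * (2 * numMatchings N) = numMatchings N ^ 2 by ring, Real.sqrt_sq hm'.le]
  let Y := Fin (k - 1) → Fin (r * N) → Bool
  let G : Y → F := fun y => GIP fun i => decode e (y i)
  let tr : F → Fin (2 * numMatchings N) → Bool := fun w t => e w (Fin.castLE (two_mul_numMatchings_le N) t)
  obtain ⟨ω, hω⟩ := exists_card_le μ (X := Fin (numMatchings N) × Y)
    (fun x => {ω | ¬ liftedHM (gadget e k r) (mkInput x.1 x.2) ((P ω).output (mkInput x.1 x.2))})
    δ hδ (fun x => herr _)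
  set out : Y → Fin (numMatchings N) → Fin (2 * numMatchings N) × Fin (2 * numMatchings N) × Bool := fun y i =>
    (P ω).output (mkInput i y) with hout
  have hscore : ∀ (i : Fin (numMatchings N)) (y : Y), score i (out y i) (tr (G y)) =
      1 - 2 * ({ω | ¬ liftedHM (gadget e k r) (mkInput i y)
        ((P ω).output (mkInput i y))} : Set Ω).indicator (fun _ => (1 : ℝ)) ω := by
    intro i y
    have hiff : ((((out y i).1, (out y i).2.1) ∈ matching (numMatchings N) i ∧
      (out y i).2.2 = xor (tr (G y) (out y i).1) (tr (G y) (out y i).2.1))) ↔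
        liftedHM (gadget e k r) (mkInput i y) ((P ω).output (mkInput i y)) := Iff.rfl
    unfold score
    by_cases h : liftedHM (gadget e k r) (mkInput i y) ((P ω).output (mkInput i y))
    · rw [if_pos (hiff.2 h), Set.indicator_of_notMem (show ω ∉ ({ω | ¬ liftedHM (gadget e k r)
        (mkInput i y) ((P ω).output (mkInput i y))} : Set Ω) from fun h' => h' h)]
      ring
    · rw [if_neg fun h' => h (hiff.1 h'), Set.indicator_of_mem h]; ring
  have hY0 : (0 : ℝ) < Fintype.card Y := by exact_mod_cast Fintype.card_pos
  have havg : (1 - 2 * δ) * numMatchings N * Fintype.card Y ≤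
      ∑ y : Y, ∑ i, score i (out y i) (tr (G y)) := by
    simp_rw [hscore, Finset.sum_sub_distrib, ← Finset.mul_sum]
    rw [Fintype.sum_prod_type_right, Fintype.card_prod, Fintype.card_fin] at hω
    push_cast at hω
    simp only [Finset.sum_const, Finset.card_univ, Fintype.card_fin, nsmul_eq_mul, mul_one]
    linarith
  have hJ : Fintype.card Y * Real.exp ((1 - 2 * δ) * √((numMatchings N : ℝ) / 2)) ≤
      ∑ y : Y, Real.exp (lam * ∑ i, score i (out y i) (tr (G y))) := by
    set a := (1 - 2 * δ) * √((numMatchings N : ℝ) / 2) with ha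
    -- Jensen's inequality through the tangent line of `exp` at `a`, the lower bound for the mean
    -- exponent.
    have h1 : ∀ y : Y, Real.exp a * (1 + (lam * ∑ i, score i (out y i) (tr (G y)) - a)) ≤
        Real.exp (lam * ∑ i, score i (out y i) (tr (G y))) := by
      intro y
      calc _ ≤ Real.exp a * Real.exp (lam * ∑ i, score i (out y i) (tr (G y)) - a) := by
            gcongr
            linarith [Real.add_one_le_exp (lam * ∑ i, score i (out y i) (tr (G y)) - a)]
        _ = _ := by rw [← Real.exp_add]; congr 1; ring
    refine le_trans ?_ (Finset.sum_le_sum fun y _ => h1 y)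
    rw [← Finset.mul_sum, Finset.sum_add_distrib, Finset.sum_sub_distrib, ← Finset.mul_sum]
    simp only [Finset.sum_const, Finset.card_univ, nsmul_eq_mul, mul_one]
    rw [mul_comm]
    gcongr
    have h2 := mul_le_mul_of_nonneg_left havg hlam0
    have h3 : lam * ((1 - 2 * δ) * numMatchings N * Fintype.card Y) = Fintype.card Y * a := by
      rw [ha, ← hlamm]; ring
    linarith
  have hmain := sum_outputs_le hk (P ω) (hc ω) G
    (fun o w => Real.exp (lam * ∑ i, score i (o i) (tr w))) (fun _ _ => (Real.exp_pos _).le)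
    (√2) (Fintype.card Y * (2 ^ N * Real.exp √((numMatchings N : ℝ) / 2) * ((k : ℝ) / 2 ^ N) ^ 4))
    (by positivity) (by positivity) (by
      intro o C _ hC
      have hkq : k ≤ Fintype.card F := by
        rw [hcard]
        exact (Nat.lt_two_pow_self.le.trans hkN).trans Nat.lt_two_pow_self.le
      have := sum_cylinder_bits_le e (by omega) (by rwa [Nat.sub_add_cancel (by omega)])
        ((Nat.sub_le k 1).trans hkq) C hC
        (fun w => Real.exp (lam * ∑ i, score i (o i) (tr w))) (Real.exp √((numMatchings N : ℝ) / 2)) (by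
          intro w
          rw [abs_of_pos (Real.exp_pos _), ← hlamm]
          gcongr
          calc _ ≤ ∑ i : Fin (numMatchings N), (1 : ℝ) := Finset.sum_le_sum fun i _ =>
                (le_abs_self _).trans (abs_score _ _ _).le
            _ = numMatchings N := by simp)
      rw [hcard] at this
      push_cast at this
      refine this.trans ?_
      gcongr
      · rw [div_le_iff₀ (by positivity), mul_comm (√2), ← e.symm.sum_comp]
        have := sum_exp_score_le (two_mul_numMatchings_le N) hm o
        refine le_of_eq_of_le (Finset.sum_congr rfl fun y _ => ?_) this
        simp only [tr, Equiv.apply_symm_apply, hlam]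
      · exact_mod_cast Nat.sub_le k 1)
  have hZ : (Fintype.card (Fin (2 * numMatchings N) × Fin (2 * numMatchings N) × Bool) : ℝ) = 8 * (numMatchings N : ℝ) ^ 2 := by
    simp only [Fintype.card_prod, Fintype.card_fin, Fintype.card_bool]
    push_cast; ring
  rw [hZ] at hmain
  refine le_of_mul_le_mul_left ((hJ.trans hmain).trans (le_of_eq ?_)) hY0
  ring

end Bound

/-! ### The extreme cases: zero error and zero communication -/

/-- The protocol in which the first player announces the value of the gadget. -/
theorem exists_zero_error_protocol {k m L : ℕ} [NeZero k] (hk : 2 ≤ k)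
    (g : (Fin (k - 1) → Fin L → Bool) → Fin (2 * m) → Bool) :
    ∃ P : DetProtocol (HMInput k m L) (Fin (2 * m) × Fin (2 * m) × Bool),
      (∀ x, liftedHM g x (P.output x)) ∧ ∀ x, P.bits x ≤ 2 * m := by
  let idx : View (HMInput k m L) (lastPlayer k) → Fin m := fun v =>
    v ⟨0, by omega⟩ (by simp only [lastPlayer, ne_eq, Fin.mk.injEq]; omega)
  let P : DetProtocol (HMInput k m L) (Fin (2 * m) × Fin (2 * m) × Bool) :=
    { msg := fun i v _ => if h : i.val = 0 then
          List.ofFn (g fun s => v ⟨s.val + 1, by omega⟩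
            (by simp only [sender, ne_eq, Fin.ext_iff, Fin.val_castLE]; omega))
        else []
      out := fun v t => (leftPos (idx v), partner (idx v) (idx v),
        xor ((t ⟨0, by omega⟩).getD (leftPos (idx v)) false)
          ((t ⟨0, by omega⟩).getD (partner (idx v) (idx v)) false)) }
  have htr : ∀ x i, P.transcript x i = if i.val = 0 then List.ofFn (g (gadgetInput x)) else [] := by
    intro x i
    rw [DetProtocol.transcript]
    by_cases h : i.val = 0
    · rw [if_pos h]; exact dif_pos h
    · rw [if_neg h]; exact dif_neg h
  refine ⟨P, fun x => ?_, fun x => ?_⟩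
  · refine ⟨mem_matching_iff.2 ⟨matchingIndex x, rfl⟩, ?_⟩
    change xor ((P.transcript x ⟨0, _⟩).getD _ false) ((P.transcript x ⟨0, _⟩).getD _ false) =
      xor (g (gadgetInput x) (leftPos (matchingIndex x)))
        (g (gadgetInput x) (partner (matchingIndex x) (matchingIndex x)))
    rw [htr, if_pos rfl]
    congr 1
    · exact (List.getD_eq_getElem _ _ (by simp)).trans (by simp; rfl)
    · exact (List.getD_eq_getElem _ _ (by simp)).trans (by simp; rfl)
  · unfold DetProtocol.bits
    rw [Finset.sum_eq_single (⟨0, by omega⟩ : Fin (k - 1))]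
    · rw [htr, if_pos rfl, List.length_ofFn]
    · intro i _ hi
      rw [htr, if_neg fun h => hi (Fin.ext h)]; rfl
    · simp

section Silent

variable {F : Type} [Field F] {N k r : ℕ}

/-- A gadget input with value `z`, of which only the last string depends on `z`. -/
def spreadInput (e : F ≃ (Fin N → Bool)) (hr : 0 < r) (z : Fin N → Bool) :
    Fin (k - 1) → Fin (r * N) → Bool := fun s =>
  (decodeEquiv e r).symm fun j =>
    if s.val = k - 2 then (if j = ⟨0, hr⟩ then e.symm z else 0) else 1

/-- All vectors but the last are constantly `1`, and the last one is supported on a single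
coordinate. Every gadget value is thus reached by changing only the string that the last player
cannot see. -/
theorem gadget_spreadInput (e : F ≃ (Fin N → Bool)) (hk : 2 ≤ k) (hr : 0 < r) (z : Fin N → Bool)
    (t : Fin (2 * numMatchings N)) :
    gadget e k r (spreadInput e hr z) t = z (Fin.castLE (two_mul_numMatchings_le N) t) := by
  have hd : ∀ s : Fin (k - 1), decode e (spreadInput e hr z s) = fun j =>
      if s.val = k - 2 then (if j = ⟨0, hr⟩ then e.symm z else 0) else 1 := fun s =>
    (decodeEquiv e r).apply_symm_apply _
  have : GIP (fun i => decode e (spreadInput (k := k) e hr z i)) = e.symm z := by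
    simp only [GIP, hd]
    have : ∀ j : Fin r, (∏ s : Fin (k - 1), if s.val = k - 2 then
        (if j = ⟨0, hr⟩ then e.symm z else 0) else 1) = if j = ⟨0, hr⟩ then e.symm z else 0 := by
      intro j
      rw [Finset.prod_eq_single (⟨k - 2, by omega⟩ : Fin (k - 1))]
      · exact if_pos rfl
      · intro s _ hs
        exact if_neg fun h => hs (Fin.ext h)
      · simp
    simp [this]
  simp only [gadget, this, Equiv.apply_symm_apply]

theorem spreadInput_congr (e : F ≃ (Fin N → Bool)) (hr : 0 < r) (z z' : Fin N → Bool)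
    (s : Fin (k - 1)) (hs : s.val ≠ k - 2) : spreadInput e hr z s = spreadInput e hr z' s := by
  simp [spreadInput, hs]

variable [NeZero k]

/-- Without communication the error is at least `1 / 2`. -/
theorem cost_pos (e : F ≃ (Fin N → Bool)) (hk : 2 ≤ k) (hr : 0 < r) (hm : 0 < numMatchings N)
    (δ : ℝ) (hδ : δ < 1 / 2) {Ω : Type} [MeasurableSpace Ω] (μ : Measure Ω)
    [IsProbabilityMeasure μ]
    (P : Ω → DetProtocol (HMInput k (numMatchings N) (r * N))
      (Fin (2 * numMatchings N) × Fin (2 * numMatchings N) × Bool)) (c : ℕ)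
    (herr : ∀ x, μ {ω | ¬ liftedHM (gadget e k r) x ((P ω).output x)} ≤ ENNReal.ofReal δ)
    (hc : ∀ ω x, (P ω).bits x ≤ c) : 1 ≤ c := by
  by_contra hc0
  obtain rfl : c = 0 := by omega
  let i₀ : Fin (numMatchings N) := ⟨0, hm⟩
  let x : (Fin N → Bool) → (j : Fin k) → HMInput k (numMatchings N) (r * N) j := fun z =>
    mkInput i₀ (spreadInput e hr z)
  have hout : ∀ ω z z', (P ω).output (x z) = (P ω).output (x z') := by
    intro ω z z'
    have htr : ∀ z, (P ω).transcript (x z) = fun _ => [] := by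
      intro z
      funext i
      have h := hc ω (x z)
      unfold DetProtocol.bits at h
      have := Finset.sum_eq_zero_iff.1 (Nat.le_zero.1 h) i (Finset.mem_univ _)
      exact List.eq_nil_of_length_eq_zero this
    have hv : view (x z) (lastPlayer k) = view (x z') (lastPlayer k) :=
      view_mkInput_congr i₀ (s := ⟨k - 2, by omega⟩)
        (fun j hj => spreadInput_congr e hr z z' j fun h => hj (Fin.ext h))
        (by simp only [lastPlayer]; omega)
    unfold DetProtocol.output
    rw [htr, htr, hv]
  let z₀ : Fin N → Bool := fun _ => false
  -- Ones on the left half only: compared with `z₀` the parity of every edge flips, so one common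
  -- answer fails on at least one of the two inputs.
  let z₁ : Fin N → Bool := fun t => decide (t.val < numMatchings N)
  have hcover : (Set.univ : Set Ω) ⊆ {ω | ¬ liftedHM (gadget e k r) (x z₀) ((P ω).output (x z₀))} ∪
      {ω | ¬ liftedHM (gadget e k r) (x z₁) ((P ω).output (x z₁))} := by
    intro ω _
    by_contra hω
    rw [Set.mem_union, not_or] at hω
    have h0 : liftedHM (gadget e k r) (x z₀) ((P ω).output (x z₀)) := not_not.1 hω.1
    have h1 : liftedHM (gadget e k r) (x z₁) ((P ω).output (x z₁)) := not_not.1 hω.2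
    rw [hout ω z₁ z₀] at h1
    obtain ⟨hM, hb0⟩ := h0
    obtain ⟨-, hb1⟩ := h1
    obtain ⟨l, hl⟩ := mem_matching_iff.1 hM
    simp only [Prod.mk.injEq] at hl
    rw [hl.1, hl.2] at hb0 hb1
    have hg : ∀ z t, gadget e k r (gadgetInput (x z)) t =
        z (Fin.castLE (two_mul_numMatchings_le N) t) := fun z t => gadget_spreadInput e hk hr z t
    rw [hg, hg] at hb0 hb1
    rw [hb0] at hb1
    simp [z₀, z₁, leftPos, partner] at hb1
  have h1 : (1 : ENNReal) ≤ ENNReal.ofReal δ + ENNReal.ofReal δ := by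
    calc (1 : ENNReal) = μ Set.univ := measure_univ.symm
      _ ≤ _ := (measure_mono hcover).trans (measure_union_le _ _)
      _ ≤ _ := add_le_add (herr _) (herr _)
  rcases le_or_gt 0 δ with h0 | h0
  · rw [← ENNReal.ofReal_add h0 h0, ENNReal.one_le_ofReal] at h1
    linarith
  · rw [ENNReal.ofReal_of_nonpos h0.le] at h1
    simp at h1

end Silent

/-! ### Numerical estimates with `t = N^(1/3)` -/

theorem numMatchings_bounds {N : ℕ} {t : ℝ} (ht0 : 0 ≤ t) (ht : t ^ 3 = N) :
    (numMatchings N : ℝ) ≤ t ^ 2 / 2 ∧ t ^ 2 / 2 - 1 < numMatchings N := by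
  have h : (N : ℝ) ^ (2 / 3 : ℝ) = t ^ 2 := by
    rw [← ht, ← Real.rpow_natCast, ← Real.rpow_natCast, ← Real.rpow_mul ht0]; norm_num
  unfold numMatchings
  rw [h]
  exact ⟨Nat.floor_le (by positivity), Nat.sub_one_lt_floor _⟩

theorem numMatchings_pos {N : ℕ} (hN : 4 ≤ N) : 0 < numMatchings N := by
  unfold numMatchings
  rw [Nat.floor_pos, le_div_iff₀ two_pos, one_mul]
  have h4 : (2 : ℝ) ≤ (4 : ℝ) ^ (2 / 3 : ℝ) := by
    rw [show (4 : ℝ) = 2 ^ (2 : ℝ) by norm_num, ← Real.rpow_mul (by norm_num)]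
    calc (2 : ℝ) = 2 ^ (1 : ℝ) := (Real.rpow_one _).symm
      _ ≤ _ := Real.rpow_le_rpow_of_exponent_le (by norm_num) (by norm_num)
  exact h4.trans (Real.rpow_le_rpow (by norm_num) (by exact_mod_cast hN) (by norm_num))

/-- The discrepancy error term is at most `1` for cheap protocols. -/
theorem error_term_le_one {N k c : ℕ} {t : ℝ} (hkN : 2 ^ k ≤ N) (ht2 : 2 ≤ t)
    (ht : t ^ 3 = N) (hlog : Real.log N ≤ 1 / 20 * t) (hc : 2 * (c : ℝ) ≤ t) :
    (2 ^ (k - 1) * 4 ^ c * (8 * (numMatchings N : ℝ) ^ 2)) ^ numMatchings N *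
        (2 ^ N * Real.exp √(numMatchings N / 2) * ((k : ℝ) / 2 ^ N) ^ 4) ≤ 1 := by
  have hm := (numMatchings_bounds (zero_le_two.trans ht2) ht).1
  have hmN : (2 : ℝ) * numMatchings N ≤ N := by exact_mod_cast two_mul_numMatchings_le N
  set m := numMatchings N
  have hN0 : (0 : ℝ) < N := by rw [← ht]; positivity
  have htN : t ≤ N := by rw [← ht]; nlinarith [sq_nonneg (t - 1)]
  have hl := Real.log_two_lt_d9
  have hl' := Real.log_two_gt_d9
  have hbase : (2 : ℝ) ^ (k - 1) * 4 ^ c * (8 * (m : ℝ) ^ 2) ≤ Real.exp t := by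
    have h1 : (2 : ℝ) ^ (k - 1) ≤ N := by
      have : 2 ^ (k - 1) ≤ N := (Nat.pow_le_pow_right two_pos (Nat.sub_le k 1)).trans hkN
      exact_mod_cast this
    have hk2 : (2 : ℝ) ^ (k - 1) * 8 * (m : ℝ) ^ 2 ≤ 2 * (N : ℝ) ^ 3 := by
      have : (m : ℝ) ^ 2 ≤ (N / 2 : ℝ) ^ 2 := by gcongr; linarith
      calc _ ≤ (N : ℝ) * 8 * (N / 2 : ℝ) ^ 2 := by gcongr
        _ = _ := by ring
    have hN2 : (2 : ℝ) ≤ N := ht2.trans htN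
    have hN4 : (N : ℝ) ^ 4 ≤ Real.exp (1 / 5 * t) := by
      calc (N : ℝ) ^ 4 = Real.exp ((4 : ℕ) * Real.log N) := by
            rw [Real.exp_nat_mul, Real.exp_log hN0]
        _ ≤ _ := Real.exp_le_exp.2 (by push_cast; linarith)
    have h4c : (4 : ℝ) ^ c ≤ Real.exp (4 / 5 * t) := by
      calc (4 : ℝ) ^ c = Real.exp (c * (2 * Real.log 2)) := by
            rw [Real.exp_nat_mul, two_mul, Real.exp_add, Real.exp_log two_pos]; norm_num
        _ ≤ _ := Real.exp_le_exp.2 (by nlinarith)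
    calc _ = ((2 : ℝ) ^ (k - 1) * 8 * (m : ℝ) ^ 2) * 4 ^ c := by ring
      _ ≤ (N : ℝ) ^ 4 * 4 ^ c := by
          gcongr
          refine hk2.trans ?_
          rw [pow_succ' (N : ℝ) 3]
          gcongr
      _ ≤ Real.exp (1 / 5 * t) * Real.exp (4 / 5 * t) := by gcongr
      _ = Real.exp t := by rw [← Real.exp_add]; congr 1; ring
  have hpow : ((2 : ℝ) ^ (k - 1) * 4 ^ c * (8 * (m : ℝ) ^ 2)) ^ m ≤ Real.exp (N / 2) := by
    calc _ ≤ (Real.exp t) ^ m := by gcongr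
      _ = Real.exp (m * t) := by rw [← Real.exp_nat_mul]
      _ ≤ _ := by
        gcongr
        rw [← ht]; nlinarith
  have hsqrt : √((m : ℝ) / 2) ≤ N / 2 := by
    refine le_trans ?_ (show t / 2 ≤ (N : ℝ) / 2 by linarith)
    rw [show t / 2 = √((t / 2) ^ 2) by rw [Real.sqrt_sq (by linarith)]]
    gcongr
    linarith
  have h2N : (2 : ℝ) ^ N = Real.exp (N * Real.log 2) := by
    rw [Real.exp_nat_mul, Real.exp_log two_pos]
  have hk4 : (k : ℝ) ≤ Real.exp (t / 10) := by
    have : (k : ℝ) ≤ N := by exact_mod_cast Nat.lt_two_pow_self.le.trans hkN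
    calc (k : ℝ) ≤ N := this
      _ = Real.exp (Real.log N) := (Real.exp_log hN0).symm
      _ ≤ _ := by gcongr; linarith
  calc _ ≤ Real.exp (N / 2) * (Real.exp (N * Real.log 2) * Real.exp (N / 2) *
        (Real.exp (t / 10) / Real.exp (N * Real.log 2)) ^ 4) := by
        rw [h2N]; gcongr
    -- The exponent is `N - 3N log 2 + 2t/5`, negative because `3 log 2 > 2` and `t ≤ N`. The fourth
    -- power in the discrepancy bound provides the needed `2^(-3N)`.
    _ = Real.exp (N / 2 + (N * Real.log 2 + N / 2 + (4 : ℕ) * (t / 10 - N * Real.log 2))) := by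
        rw [Real.exp_add, Real.exp_add, Real.exp_add, Real.exp_nat_mul (t / 10 - _) 4, Real.exp_sub]
    _ ≤ Real.exp 0 := by
        gcongr
        push_cast
        nlinarith
    _ = 1 := Real.exp_zero

theorem exists_cost_bound : ∃ κ : ℝ, 0 < κ ∧ ∀ (δ : ℝ) (N k c : ℕ), 0 ≤ δ → δ < 1 / 2 →
    2 ^ k ≤ N → 1 ≤ c →
    Real.exp ((1 - 2 * δ) * √(numMatchings N / 2)) ≤
      2 * 4 ^ c * (√2 + (2 ^ (k - 1) * 4 ^ c * (8 * (numMatchings N : ℝ) ^ 2)) ^ numMatchings N *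
        (2 ^ N * Real.exp √(numMatchings N / 2) * ((k : ℝ) / 2 ^ N) ^ 4)) →
    κ * (1 - 2 * δ) * (N : ℝ) ^ (1 / 3 : ℝ) ≤ c := by
  have hev : ∀ᶠ N : ℕ in Filter.atTop, Real.log N ≤ 1 / 20 * (N : ℝ) ^ (1 / 3 : ℝ) := by
    have h := ((isLittleO_log_rpow_atTop (r := 1 / 3) (by norm_num)).comp_tendsto
      tendsto_natCast_atTop_atTop).bound (c := 1 / 20) (by norm_num)
    filter_upwards [h] with N hN
    simp only [Function.comp_apply, Real.norm_eq_abs] at hN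
    rw [abs_of_nonneg (Real.rpow_nonneg (Nat.cast_nonneg N) _)] at hN
    exact (le_abs_self _).trans hN
  obtain ⟨N₀, hN₀⟩ := Filter.eventually_atTop.1 hev
  -- For `N < N₀ + 8` the second term makes the claim follow from `1 ≤ c`. For larger `N`, either `t
  -- < 2c` suffices, or `√(m/2) ≥ t/3` and the upper bound `exp(4c)` give the factor `1/12`.
  refine ⟨min (1 / 12) (1 / (N₀ + 8 : ℝ)), by positivity, ?_⟩
  intro δ N k c hδ hδ' hkN hc hexp
  have hN1 : 1 ≤ N := Nat.one_le_two_pow.trans hkN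
  set t : ℝ := (N : ℝ) ^ (1 / 3 : ℝ) with ht
  have hN1' : (1 : ℝ) ≤ N := by exact_mod_cast hN1
  have ht1 : 1 ≤ t := Real.one_le_rpow hN1' (by norm_num)
  have ht3 : t ^ 3 = N := by
    rw [ht, ← Real.rpow_natCast, ← Real.rpow_mul (by positivity)]; norm_num
  have hc1 : (1 : ℝ) ≤ c := by exact_mod_cast hc
  have hd0 : 0 < 1 - 2 * δ := by linarith
  have hd1 : 1 - 2 * δ ≤ 1 := by linarith
  rcases lt_or_ge N (N₀ + 8) with hlt | hge
  · have hlt' : (N : ℝ) ≤ N₀ + 8 := by exact_mod_cast hlt.le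
    have htN : t ≤ N := by rw [← ht3]; nlinarith [sq_nonneg (t - 1)]
    calc _ ≤ 1 / (N₀ + 8 : ℝ) * 1 * (N₀ + 8) := by
          gcongr
          · exact min_le_right _ _
          · linarith
      _ = 1 := by field_simp
      _ ≤ c := hc1
  · have hlog := hN₀ N (by omega)
    rw [← ht] at hlog
    have h12 : min (1 / 12) (1 / (N₀ + 8 : ℝ)) * (1 - 2 * δ) * t ≤ 1 / 12 * ((1 - 2 * δ) * t) := by
      rw [mul_assoc]
      exact mul_le_mul_of_nonneg_right (min_le_left _ _) (by positivity)
    refine h12.trans ?_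
    rcases lt_or_ge t (2 * (c : ℝ)) with hct | hct
    · nlinarith
    · have ht2 : 2 ≤ t := by
        by_contra h
        have h8 : (8 : ℝ) ≤ N := by exact_mod_cast (by omega : 8 ≤ N)
        have : t ^ 3 < 2 ^ 3 := by
          gcongr; linarith
        linarith
      have herr := error_term_le_one (k := k) hkN ht2 ht3 hlog hct
      have hm := (numMatchings_bounds (zero_le_one.trans ht1) ht3).2
      have hsqrt : t / 3 ≤ √((numMatchings N : ℝ) / 2) := by
        apply Real.le_sqrt_of_sq_le
        nlinarith
      have h5 : 2 * (√2 + 1) ≤ Real.exp (2 * c) := by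
        have h2 : √2 ≤ 3 / 2 := Real.sqrt_le_iff.2 ⟨by norm_num, by norm_num⟩
        have he : Real.exp 2 ≤ Real.exp (2 * c) := by gcongr; linarith
        have he2 : Real.exp 2 = Real.exp 1 * Real.exp 1 := by rw [← Real.exp_add]; norm_num
        nlinarith [Real.exp_one_gt_d9]
      have h4 : (4 : ℝ) ^ c ≤ Real.exp (2 * c) := by
        have : (4 : ℝ) ≤ Real.exp 2 := by
          have he2 : Real.exp 2 = Real.exp 1 * Real.exp 1 := by rw [← Real.exp_add]; norm_num
          nlinarith [Real.exp_one_gt_d9]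
        calc (4 : ℝ) ^ c ≤ (Real.exp 2) ^ c := by gcongr
          _ = _ := by rw [← Real.exp_nat_mul, mul_comm]
      have hfin : Real.exp ((1 - 2 * δ) * √(numMatchings N / 2)) ≤ Real.exp (4 * c) := by
        calc _ ≤ 2 * 4 ^ c * (√2 + 1) := hexp.trans (by gcongr)
          _ = 4 ^ c * (2 * (√2 + 1)) := by ring
          _ ≤ Real.exp (2 * c) * Real.exp (2 * c) := by gcongr
          _ = _ := by rw [← Real.exp_add]; congr 1; ring
      rw [Real.exp_le_exp] at hfin
      nlinarith [mul_le_mul_of_nonneg_left hsqrt hd0.le]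

theorem randomizedComplexity_lower_bound (δ : ℝ) (hδ : 0 ≤ δ) (hδ' : δ < 1 / 2) :
    ∃ c : ℝ, 0 < c ∧ ∀ (k N r : ℕ) [NeZero k], 2 ≤ k → 2 ^ k ≤ N → 2 ^ k ≤ r →
      ∀ (F : Type) [Field F] (e : F ≃ (Fin N → Bool)),
        c * (N : ℝ) ^ (1 / 3 : ℝ) ≤
          (randomizedComplexity (k := k) (liftedHM (gadget e k r)) δ : ℝ) := by
  obtain ⟨κ, hκ, h⟩ := exists_cost_bound
  refine ⟨κ * (1 - 2 * δ), mul_pos hκ (by linarith), ?_⟩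
  intro k N r _ hk hkN hr F _ e
  have hN4 : 4 ≤ N := (Nat.pow_le_pow_right two_pos hk).trans hkN
  have hm := numMatchings_pos hN4
  have hr0 : 0 < r := (Nat.two_pow_pos k).trans_le hr
  unfold randomizedComplexity
  -- The infimum of an empty set of naturals would be `0`. The trivial zero-error protocol shows
  -- that the set of costs is nonempty, so the infimum is attained.
  have hmem := Nat.sInf_mem (s := {c : ℕ | ∃ (Ω : Type) (_ : MeasurableSpace Ω) (μ : Measure Ω)
    (_ : IsProbabilityMeasure μ) (P : Ω → DetProtocol (HMInput k (numMatchings N) (r * N))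
      (Fin (2 * numMatchings N) × Fin (2 * numMatchings N) × Bool)),
      (∀ x, μ {ω | ¬ liftedHM (gadget e k r) x ((P ω).output x)} ≤ ENNReal.ofReal δ) ∧
      (∀ ω x, (P ω).bits x ≤ c)}) (by
    obtain ⟨P, hP, hb⟩ := exists_zero_error_protocol hk (gadget e k r)
    refine ⟨2 * numMatchings N, Unit, inferInstance, Measure.dirac (), inferInstance, fun _ => P,
      fun x => ?_, fun _ => hb⟩
    simp [hP])
  obtain ⟨Ω, _, μ, _, P, herr, hc⟩ := hmem
  exact h δ N k _ hδ hδ' hkN (cost_pos e hk hr0 hm δ hδ' μ P _ herr hc)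
    (exp_le_of_protocol e hk hkN hr hm δ hδ μ P _ herr hc)

/-! ### The quantum protocol -/

section Quantum

variable {m : ℕ} {B : Type} [Fintype B] [DecidableEq B]

/-- The unnormalized vector `|ℓ⟩ + (-1) ^ b |r⟩`. -/
noncomputable def edgeVec (ι : Fin (2 * m) → B) (z : Fin (2 * m) × Fin (2 * m) × Bool) : B → ℂ :=
  Pi.single (ι z.1) 1 + (sgn z.2.2 : ℂ) • Pi.single (ι z.2.1) 1

open Classical in
/-- The projection onto the state of the edge answer `z`, or zero if `z` does not name an edge of
the `i`-th matching. -/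
noncomputable def edgeProj (ι : Fin (2 * m) → B) (i : Fin m)
    (z : Fin (2 * m) × Fin (2 * m) × Bool) : Matrix B B ℂ :=
  if (z.1, z.2.1) ∈ matching m i then
    (1 / 2 : ℂ) • Matrix.vecMulVec (edgeVec ι z) (star (edgeVec ι z)) else 0

/-- The projection onto the basis states that do not encode a position. -/
noncomputable def unusedProj (ι : Fin (2 * m) → B) : Matrix B B ℂ :=
  Matrix.diagonal fun b => if ∃ t, ι t = b then 0 else 1

theorem edgeProj_posSemidef (ι : Fin (2 * m) → B) (i : Fin m)
    (z : Fin (2 * m) × Fin (2 * m) × Bool) : (edgeProj ι i z).PosSemidef := by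
  unfold edgeProj
  split_ifs
  · exact (Matrix.posSemidef_vecMulVec_self_star _).smul (by positivity)
  · exact Matrix.PosSemidef.zero

omit [Fintype B] in
theorem unusedProj_posSemidef (ι : Fin (2 * m) → B) : (unusedProj ι).PosSemidef := by
  refine Matrix.PosSemidef.diagonal fun b => ?_
  simp only [Pi.zero_apply]
  split_ifs <;> simp

omit [Fintype B] in
theorem star_edgeVec (ι : Fin (2 * m) → B) (z : Fin (2 * m) × Fin (2 * m) × Bool) :
    star (edgeVec ι z) = edgeVec ι z := by
  ext b
  simp only [edgeVec, Pi.star_apply, Pi.add_apply, Pi.smul_apply, Pi.single_apply, smul_eq_mul,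
    star_add, star_mul', apply_ite star, star_one, star_zero]
  congr 2
  exact Complex.conj_ofReal _

-- The cross terms of the two signs cancel, leaving the projections onto the two endpoints.
omit [Fintype B] in
theorem sum_bool_edgeProj (ι : Fin (2 * m) → B) (u v : Fin (2 * m)) :
    ∑ b : Bool, (1 / 2 : ℂ) • Matrix.vecMulVec (edgeVec ι (u, v, b)) (star (edgeVec ι (u, v, b))) =
      Matrix.diagonal (Pi.single (ι u) 1) + Matrix.diagonal (Pi.single (ι v) 1) := by
  have hdiag : ∀ c a b : B, (Matrix.diagonal (Pi.single c 1) : Matrix B B ℂ) a b =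
      (Pi.single c 1 : B → ℂ) a * (Pi.single c 1 : B → ℂ) b := by
    intro c a b
    rw [Matrix.diagonal_apply, Pi.single_apply, Pi.single_apply]
    by_cases hab : a = b
    · subst hab; by_cases h : a = c <;> simp [h]
    · by_cases h1 : a = c <;> by_cases h2 : b = c <;> simp_all
  ext a b
  simp only [star_edgeVec]
  simp only [Fintype.sum_bool, Matrix.add_apply, Matrix.smul_apply,
    Matrix.vecMulVec_apply, hdiag, edgeVec, sgn, Pi.add_apply, Pi.smul_apply, smul_eq_mul]
  simp only [if_true, Bool.false_eq_true, if_false]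
  push_cast
  ring

theorem partner_right_injective (i : Fin m) : Function.Injective (partner i) := by
  intro l l' h
  simp only [partner, Fin.mk.injEq, Nat.add_left_cancel_iff] at h
  have : l.val ≡ l'.val [MOD m] := Nat.ModEq.add_left_cancel' i.val h
  rw [Nat.ModEq, Nat.mod_eq_of_lt l.isLt, Nat.mod_eq_of_lt l'.isLt] at this
  exact Fin.ext this

/-- The matching covers every position exactly once. -/
theorem bijective_endpoints (i : Fin m) :
    Function.Bijective (Sum.elim (leftPos (m := m)) (partner i)) := by
  rw [Fintype.bijective_iff_injective_and_card]
  refine ⟨?_, by simp [two_mul]⟩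
  have hne : ∀ l l', leftPos l ≠ partner i l' := by
    intro l l' h
    simp only [leftPos, partner, Fin.mk.injEq] at h
    have := l.isLt
    omega
  rintro (l | l) (l' | l') h
  · simp only [Sum.elim_inl, leftPos, Fin.mk.injEq] at h
    rw [Fin.ext h]
  · exact absurd h (hne _ _)
  · exact absurd h.symm (hne _ _)
  · rw [partner_right_injective i h]

omit [Fintype B] in
theorem sum_edgeProj (ι : Fin (2 * m) → B) (i : Fin m) :
    ∑ z, edgeProj ι i z = ∑ t, Matrix.diagonal (Pi.single (ι t) 1) := by
  classical
  have hpair : ∀ p : Fin (2 * m) × Fin (2 * m), ∑ b : Bool, edgeProj ι i (p.1, p.2, b) =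
      if p ∈ matching m i then
        (Matrix.diagonal (Pi.single (ι p.1) 1) + Matrix.diagonal (Pi.single (ι p.2) 1) :
          Matrix B B ℂ) else 0 := by
    rintro ⟨u, v⟩
    by_cases h : (u, v) ∈ matching m i
    · rw [if_pos h, ← sum_bool_edgeProj]
      exact Finset.sum_congr rfl fun b _ => if_pos h
    · rw [if_neg h]
      exact Finset.sum_eq_zero fun b _ => if_neg h
  have hfilter : (Finset.univ.filter fun p => p ∈ matching m i) =
      Finset.univ.image fun l => (leftPos l, partner i l) := by
    ext p
    simp only [Finset.mem_filter, Finset.mem_univ, true_and, Finset.mem_image, mem_matching_iff]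
    exact exists_congr fun l => eq_comm
  rw [← (Equiv.prodAssoc _ _ _).sum_comp, Fintype.sum_prod_type]
  simp only [Equiv.prodAssoc_apply]
  rw [Finset.sum_congr rfl fun p _ => hpair p, ← Finset.sum_filter, hfilter, Finset.sum_image
    (fun l _ l' _ h => partner_right_injective i (Prod.mk.inj h).2), Finset.sum_add_distrib,
    ← (Equiv.ofBijective _ (bijective_endpoints i)).sum_comp, Fintype.sum_sum_type]
  rfl

omit [Fintype B] in
theorem sum_diagonal_add_unusedProj {ι : Fin (2 * m) → B} (hι : Function.Injective ι) :
    ∑ t, Matrix.diagonal (Pi.single (ι t) 1) + unusedProj ι = 1 := by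
  have h : ∑ t, (Matrix.diagonal (Pi.single (ι t) 1) : Matrix B B ℂ) =
      Matrix.diagonal (∑ t, Pi.single (ι t) 1) :=
    (map_sum (Matrix.diagonalAddMonoidHom B ℂ) _ _).symm
  rw [h, unusedProj, Matrix.diagonal_add, ← Matrix.diagonal_one]
  congr 1
  funext b
  rw [Finset.sum_apply]
  simp only [Pi.single_apply]
  by_cases hb : ∃ t, ι t = b
  · obtain ⟨t, rfl⟩ := hb
    simp [hι.eq_iff]
  · rw [if_neg hb, Finset.sum_eq_zero fun t _ => if_neg fun h => hb ⟨t, h.symm⟩, zero_add]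

/-- The state `∑ t, (-1) ^ g t |t⟩`, normalized. -/
noncomputable def phaseState (ι : Fin (2 * m) → B) (g : Fin (2 * m) → Bool) : B → ℂ :=
  Function.extend ι (fun t => ((sgn (g t) / √(2 * m) : ℝ) : ℂ)) 0

omit [DecidableEq B] in
theorem phaseState_norm {ι : Fin (2 * m) → B} (hι : Function.Injective ι) (hm : 0 < m)
    (g : Fin (2 * m) → Bool) : ∑ b, ‖phaseState ι g b‖ ^ 2 = 1 := by
  have hm' : (0 : ℝ) < m := by exact_mod_cast hm
  rw [← Fintype.sum_of_injective ι hι (fun _ => 1 / (2 * m : ℝ))]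
  · simp only [Finset.sum_const, Finset.card_univ, Fintype.card_fin, nsmul_eq_mul]
    push_cast
    field_simp
  · intro b hb
    rw [phaseState, Function.extend_apply' _ _ _ hb]
    simp
  · intro t
    rw [phaseState, hι.extend_apply, Complex.norm_real, Real.norm_eq_abs, sq_abs, div_pow, sgn_sq,
      Real.sq_sqrt (by positivity)]

theorem unusedProj_mulVec_phaseState (ι : Fin (2 * m) → B) (g : Fin (2 * m) → Bool) :
    (unusedProj ι).mulVec (phaseState ι g) = 0 := by
  funext b
  rw [unusedProj, Matrix.mulVec_diagonal, Pi.zero_apply]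
  by_cases hb : ∃ t, ι t = b
  · rw [if_pos hb, zero_mul]
  · rw [phaseState, Function.extend_apply' _ _ _ hb]; simp

/-- For an edge answer with the wrong parity, the two amplitudes of the state cancel in the inner
product with the edge vector. -/
theorem edgeProj_mulVec_phaseState {ι : Fin (2 * m) → B} (hι : Function.Injective ι) (i : Fin m)
    (z : Fin (2 * m) × Fin (2 * m) × Bool) (g : Fin (2 * m) → Bool)
    (hz : ¬ ((z.1, z.2.1) ∈ matching m i ∧ z.2.2 = xor (g z.1) (g z.2.1))) :
    (edgeProj ι i z).mulVec (phaseState ι g) = 0 := by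
  unfold edgeProj
  split_ifs with h
  · have hb : z.2.2 ≠ xor (g z.1) (g z.2.1) := fun hb => hz ⟨h, hb⟩
    have h0 : edgeVec ι z ⬝ᵥ phaseState ι g = 0 := by
      have hs : (sgn (g z.1) + sgn z.2.2 * sgn (g z.2.1) : ℝ) = 0 := by
        revert hb
        cases z.2.2 <;> cases g z.1 <;> cases g z.2.1 <;> simp [sgn]
      rw [edgeVec, add_dotProduct, smul_dotProduct, single_one_dotProduct, single_one_dotProduct,
        phaseState, hι.extend_apply, hι.extend_apply, smul_eq_mul, ← Complex.ofReal_mul,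
        ← Complex.ofReal_add, ← mul_div_assoc, ← add_div, hs, zero_div, Complex.ofReal_zero]
    rw [Matrix.smul_mulVec, star_edgeVec, Matrix.vecMulVec_mulVec, h0]
    simp
  · exact Matrix.zero_mulVec _

/-- The zero-error quantum protocol for the lifted hidden matching problem. -/
theorem exists_quantum_protocol {k L : ℕ} [NeZero k] (hk : 2 ≤ k) (hm : 0 < m)
    (g : (Fin (k - 1) → Fin L → Bool) → Fin (2 * m) → Bool) :
    ∃ Q : QuantumProtocol (HMInput k m L) (Fin (2 * m) × Fin (2 * m) × Bool),
      Q.qubits = Nat.clog 2 (2 * m) ∧ ∀ x, Q.errorProb (liftedHM g) x = 0 := by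
  set q := Nat.clog 2 (2 * m)
  obtain ⟨⟨ι, hι⟩⟩ : Nonempty (Fin (2 * m) ↪ (Fin q → Bool)) :=
    Function.Embedding.nonempty_of_card_le (by simpa using Nat.le_pow_clog one_lt_two (2 * m))
  let gad : View (HMInput k m L) (firstPlayer k) → Fin (2 * m) → Bool := fun v =>
    g fun s => v ⟨s.val + 1, by omega⟩ (by simp [firstPlayer])
  let idx : View (HMInput k m L) (lastPlayer k) → Fin m := fun v =>
    v ⟨0, by omega⟩ (by simp only [lastPlayer, ne_eq, Fin.mk.injEq]; omega)
  -- An arbitrary answer that absorbs the projection onto unused basis states, to complete the POVM.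
  -- It does no harm: the state has no component there.
  let z₀ : Fin (2 * m) × Fin (2 * m) × Bool := (leftPos ⟨0, hm⟩, leftPos ⟨0, hm⟩, false)
  let Q : QuantumProtocol (HMInput k m L) (Fin (2 * m) × Fin (2 * m) × Bool) :=
    { qubits := q
      state := fun v => phaseState ι (gad v)
      state_norm := fun v => phaseState_norm hι hm _
      effect := fun v z => edgeProj ι (idx v) z + if z = z₀ then unusedProj ι else 0
      effect_posSemidef := fun v z => by
        refine (edgeProj_posSemidef ι _ z).add ?_
        split_ifs
        · exact unusedProj_posSemidef ι
        · exact Matrix.PosSemidef.zero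
      effect_sum := fun v => by
        rw [Finset.sum_add_distrib, sum_edgeProj, Finset.sum_ite_eq', if_pos (Finset.mem_univ _),
          sum_diagonal_add_unusedProj hι] }
  refine ⟨Q, rfl, fun x => ?_⟩
  unfold QuantumProtocol.errorProb
  refine Finset.sum_eq_zero fun z _ => ?_
  split_ifs with hz
  · rfl
  · have h0 : (edgeProj ι (matchingIndex x) z + if z = z₀ then unusedProj ι else 0).mulVec
        (phaseState ι (g (gadgetInput x))) = 0 := by
      rw [Matrix.add_mulVec, edgeProj_mulVec_phaseState hι _ _ _ hz, zero_add]
      split_ifs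
      · exact unusedProj_mulVec_phaseState _ _
      · exact Matrix.zero_mulVec _
    change (star (phaseState ι (g (gadgetInput x))) ⬝ᵥ
      (edgeProj ι (matchingIndex x) z + if z = z₀ then unusedProj ι else 0).mulVec
        (phaseState ι (g (gadgetInput x)))).re = 0
    rw [h0, dotProduct_zero, Complex.zero_re]

end Quantum

theorem clog_two_mul_numMatchings_le {N n : ℕ} (hN : 4 ≤ N) (hn : N ≤ n) :
    (Nat.clog 2 (2 * numMatchings N) : ℝ) ≤ 2 * Real.logb 2 n := by
  have hm := numMatchings_pos hN
  have h2m := two_mul_numMatchings_le N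
  have hlt := Nat.pow_pred_clog_lt_self one_lt_two (show 1 < 2 * numMatchings N by omega)
  set q := Nat.clog 2 (2 * numMatchings N)
  have hn0 : (0 : ℝ) < n := by exact_mod_cast (by omega : 0 < n)
  have h1 : ((q.pred : ℕ) : ℝ) ≤ Real.logb 2 n := by
    rw [Real.le_logb_iff_rpow_le one_lt_two hn0, Real.rpow_natCast]
    exact_mod_cast (hlt.le.trans h2m).trans hn
  have h2 : 1 ≤ Real.logb 2 n := by
    rw [Real.le_logb_iff_rpow_le one_lt_two hn0, Real.rpow_one]
    exact_mod_cast (by omega : 2 ≤ n)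
  have h3 : (q : ℝ) ≤ (q.pred : ℕ) + 1 := by
    exact_mod_cast (by have := Nat.succ_pred_eq_of_pos (n := q); omega : q ≤ q.pred + 1)
  linarith

end NOF

/-! ### The separation -/

theorem theorem1 :
    (∀ δ : ℝ, 0 ≤ δ → δ < 1 / 2 → ∃ c : ℝ, 0 < c ∧
      ∀ (k n N r : ℕ) [NeZero k], 2 ≤ k → n = 2 ^ k * N → 4 ^ k ≤ n → 2 ^ k ≤ r →
      ∀ (F : Type) [Field F] (e : F ≃ (Fin N → Bool)),
        c * ((n : ℝ) ^ (1 / 3 : ℝ) / (2 : ℝ) ^ ((k : ℝ) / 3)) ≤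
          (NOF.randomizedComplexity (k := k) (NOF.liftedHM (NOF.gadget e k r)) δ : ℝ)) ∧
    (∃ C : ℝ, 0 < C ∧
      ∀ (k n N r : ℕ) [NeZero k], 2 ≤ k → n = 2 ^ k * N → 4 ^ k ≤ n → 2 ^ k ≤ r →
      ∀ (F : Type) [Field F] (e : F ≃ (Fin N → Bool)),
        ∃ Q : NOF.QuantumProtocol (NOF.HMInput k (NOF.numMatchings N) (r * N))
            (Fin (2 * NOF.numMatchings N) × Fin (2 * NOF.numMatchings N) × Bool),
          (Q.qubits : ℝ) ≤ C * Real.logb 2 n ∧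
            ∀ x, Q.errorProb (NOF.liftedHM (NOF.gadget e k r)) x = 0) := by
  
  -- The condition `k ≤ (log₂ n)/2` reads `4^k ≤ n`; dividing by `2^k` gives the form used above.
  have hpow : ∀ {k n N : ℕ}, n = 2 ^ k * N → 4 ^ k ≤ n → 2 ^ k ≤ N := by
    intro k n N hn h4
    rw [hn, show 4 = 2 * 2 from rfl, mul_pow] at h4
    exact Nat.le_of_mul_le_mul_left h4 (Nat.two_pow_pos k)
  refine ⟨fun δ hδ hδ' => ?_, 2, two_pos, ?_⟩
  · obtain ⟨c, hc, h⟩ := NOF.randomizedComplexity_lower_bound δ hδ hδ'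
    refine ⟨c, hc, fun k n N r _ hk hn h4 hr F _ e => ?_⟩
    have hN : (n : ℝ) ^ (1 / 3 : ℝ) / (2 : ℝ) ^ ((k : ℝ) / 3) = (N : ℝ) ^ (1 / 3 : ℝ) := by
      rw [hn, Nat.cast_mul, Real.mul_rpow (by positivity) (by positivity), Nat.cast_pow,
        Nat.cast_ofNat, ← Real.rpow_natCast, ← Real.rpow_mul zero_le_two, mul_one_div,
        mul_div_cancel_left₀ _ (by positivity)]
    rw [hN]
    exact h k N r hk (hpow hn h4) hr F e
  · intro k n N r _ hk hn h4 hr F _ e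
    have hN4 : 4 ≤ N := (Nat.pow_le_pow_right two_pos hk).trans (hpow hn h4)
    obtain ⟨Q, hQ, herr⟩ := NOF.exists_quantum_protocol hk (NOF.numMatchings_pos hN4)
      (NOF.gadget e k r)
    refine ⟨Q, ?_, herr⟩
    rw [hQ]
    exact NOF.clog_two_mul_numMatchings_le hN4
      (hn ▸ Nat.le_mul_of_pos_left N (Nat.two_pow_pos k))
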